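/- Let $d\ge 1$, let $I^d=(0,1)^d$, and let $\omega_d$ be the Lebesgue measure of the unit ball of $\mathbb{R}^d$. For $\alpha>0$ and $n\in\mathbb{N}$ put $r=\alpha n^{-1/d}$ and let $\mathcal{A}(\alpha,n)$ be the family of all sets $\Sigma=\overline{I^d}\cap\bigcup_{i=1}^n\overline{B(x_i,r)}$ with $x_1,\dots,x_n$ in the $r$-neighbourhood of $I^d$. For such $\Sigma$ let $u_\Sigma\in H^1_0(I^d\setminus\Sigma)$ be the weak solution of $-\Delta u=1$ in $I^d\setminus\Sigma$, $u=0$ in $\Sigma\cup\partial I^d$, that is, $\int_{I^d}\nabla u_\Sigma\cdot\nabla\varphi=\int_{I^d}\varphi$ for all $\varphi\in H^1_0(I^d\setminus\Sigma)$, and let $F(\Sigma)=\int_{I^d}u_\Sigma$ be its compliance. Define $$\theta(\alpha)=\inf\Big\{\liminf_{n\to\infty} n^{2/d}F(\Sigma_n)\ :\ \Sigma_n\in\mathcal{A}(\alpha,n)\text{ for all }n\Big\}\quad(\alpha>0),\qquad t_1=\inf\{t>0:\theta(t)=0\}.$$ Then $\theta$ is finite on $(0,\infty)$, $t_1>0$,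 and $\theta$ is differentiable at almost every $\alpha\in(0,t_1)$. For every $\alpha\in(0,t_1)$ at which $\theta$ is differentiable, $$-\theta'(\alpha)\ \ge\ \frac{\alpha^{1-d}}{d\,\omega_d}-\frac{2\alpha}{d}.$$ Moreover, there is a constant $C=C(d)$ such that for all $\alpha\in(0,t_1)$ $$\theta(\alpha)\ \ge\ \frac{\alpha^{2-d}}{d(d-2)\,\omega_d}-C\quad\text{if } d\ge 3,\qquad \theta(\alpha)\ \ge\ \frac{\log(\alpha^{-1})}{2\pi}-C\quad\text{if } d=2.$$ -/

import Mathlib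

open MeasureTheory Set Filter Topology
open scoped ENNReal ContDiff

namespace OptimalCompliance

/-- The Euclidean space `ℝ^d`. -/
abbrev E (d : ℕ) := EuclideanSpace ℝ (Fin d)

/-- Test functions on `U`: the space `C_c^∞(U)`, each function being extended by zero to `ℝ^d`. -/
def IsTestFunction {d : ℕ} (U : Set (E d)) (φ : E d → ℝ) : Prop :=
  ContDiff ℝ ∞ φ ∧ HasCompactSupport φ ∧ tsupport φ ⊆ U

/-- `u ∈ H¹₀(U)` with weak gradient `g`, both extended by zero to `ℝ^d`: the pair `(u, g)` is a limit
in `L²` of pairs `(φ, ∇φ)` with `φ ∈ C_c^∞(U)`, so `u` is in the closure of `C_c^∞(U)` for the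
`H¹`-norm. -/
def MemH10With {d : ℕ} (U : Set (E d)) (u : E d → ℝ) (g : E d → E d) : Prop :=
  MemLp u 2 volume ∧ MemLp g 2 volume ∧
    ∃ φ : ℕ → E d → ℝ, (∀ k, IsTestFunction U (φ k)) ∧
      Tendsto (fun k => eLpNorm (fun x => φ k x - u x) 2 volume) atTop (𝓝 0) ∧
      Tendsto (fun k => eLpNorm (fun x => gradient (φ k) x - g x) 2 volume) atTop (𝓝 0)

/-- `u` is a weak solution of `-Δu = f` in `Ω \ S`, `u = 0` in `S ∪ ∂Ω`: that is, `u ∈ H¹₀(Ω \ S)` and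
`∫_Ω ∇u · ∇φ = ∫_Ω f φ` for all `φ ∈ H¹₀(Ω \ S)`. -/
def IsWeakSolution {d : ℕ} (f : E d → ℝ) (S Ω : Set (E d)) (u : E d → ℝ) : Prop :=
  ∃ g : E d → E d, MemH10With (Ω \ S) u g ∧
    ∀ (φ : E d → ℝ) (h : E d → E d), MemH10With (Ω \ S) φ h →
      ∫ x in Ω, inner ℝ (g x) (h x) = ∫ x in Ω, f x * φ x

open Classical in
/-- The weak solution `u_{f,S,Ω}` (unique up to null sets when `Ω` is bounded). -/
noncomputable def solution {d : ℕ} (f : E d → ℝ) (S Ω : Set (E d)) : E d → ℝ :=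
  if h : ∃ u, IsWeakSolution f S Ω u then h.choose else 0

/-- The compliance `F(S, f, Ω) = ∫_Ω f u_{f,S,Ω}`. -/
noncomputable def compliance {d : ℕ} (S : Set (E d)) (f : E d → ℝ) (Ω : Set (E d)) : ℝ :=
  ∫ x in Ω, f x * solution f S Ω x

/-- The class `A(α, n)(Ω)` of the traces on the closure of `Ω` of unions of `n` closed balls of radius
`r = α n^{-1/d}` with centres in the `r`-neighbourhood of `Ω`. -/
def admissible {d : ℕ} (α : ℝ) (n : ℕ) (Ω : Set (E d)) : Set (Set (E d)) :=
  {S | ∃ x : Fin n → E d,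
    (∀ i, x i ∈ Metric.thickening (α * (n : ℝ) ^ (-(1 / (d : ℝ)))) Ω) ∧
    S = closure Ω ∩ ⋃ i, Metric.closedBall (x i) (α * (n : ℝ) ^ (-(1 / (d : ℝ))))}

/-- The open unit cube `(0,1)^d`. -/
def unitCube (d : ℕ) : Set (E d) := {x | ∀ i, x i ∈ Ioo (0 : ℝ) 1}

/-- The infimum of `liminf_n n^{2/d} F(Σ_n, 1, I^d)` over all sequences `Σ_n ∈ A(α, n)(I^d)`, as an
element of `[0, ∞]` (the lower limit is infinite for some sequences). -/
noncomputable def thetaExt (d : ℕ) (α : ℝ) : ℝ≥0∞ :=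
  ⨅ (S : ℕ → Set (E d)) (_ : ∀ n, S n ∈ admissible α n (unitCube d)),
    liminf (fun n : ℕ =>
      ENNReal.ofReal ((n : ℝ) ^ (2 / (d : ℝ)) * compliance (S n) (fun _ => 1) (unitCube d))) atTop

/-- The function `θ` as a real-valued function. -/
noncomputable def theta (d : ℕ) (α : ℝ) : ℝ := (thetaExt d α).toReal

/-- The first vanishing point `t₁` of `θ` on the positive half-line. -/
noncomputable def t₁ (d : ℕ) : ℝ := sInf {t : ℝ | 0 < t ∧ thetaExt d t = 0}

/-- The Lebesgue measure `ω_d` of the unit ball of `ℝ^d`. -/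
noncomputable def unitBallVolume (d : ℕ) : ℝ := volume.real (Metric.ball (0 : E d) 1)

end OptimalCompliance

/-!
The number `F(S)` is the supremum of `2 ∫ φ - ∫ |∇φ|²` over the test functions `φ` vanishing near
`S`. The inequality behind everything compares `θ` at two radii `α < β`. Enlarge the balls from
radius `α n^(-1/d)` to radius `β n^(-1/d)`, take a competitor `φ` for the large balls, and add to it
a function which is equal to `q (β - α) n^(-2/d)` away from the large balls and decreases with slope
`q n^(-1/d)` to `0` across the spherical shells. The shells and the support of `φ` are disjoint, so
the Dirichlet energies add up, the shells contributing at most `q² ω_d (β^d - α^d)` after scaling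
by `n^(2/d)`, while the integral grows by at least `q (β - α) (1 - ω_d β^d)`. Hence
`θ(α) ≥ θ(β) + 2 q (β - α) (1 - ω_d β^d) - q² ω_d (β^d - α^d)` for every `q ≥ 0`. With `q = 0` this
is monotonicity, hence almost everywhere differentiability; letting `β → α` and taking
`q = α^(1-d) / (d ω_d)` gives the bound for `-θ'`, and integrating that bound gives the lower bounds
for `θ`. Upper bounds for `θ` come from periodic arrangements that are dense enough in all but one
direction to meet every segment of length of order `n^(-1/d)` in the remaining direction.
-/

namespace OptimalCompliance

variable {d : ℕ}

/-! ### Gradients and test functions -/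

section Gradient

variable {F : Type*} [NormedAddCommGroup F] [InnerProductSpace ℝ F] [CompleteSpace F]
  {f g : F → ℝ} {x : F}

theorem gradient_fun_add (hf : DifferentiableAt ℝ f x) (hg : DifferentiableAt ℝ g x) :
    gradient (fun y => f y + g y) x = gradient f x + gradient g x := by
  simp only [gradient, fderiv_fun_add hf hg, map_add]

theorem gradient_fun_const_mul (hf : DifferentiableAt ℝ f x) (c : ℝ) :
    gradient (fun y => c * f y) x = c • gradient f x := by
  simp only [gradient, fderiv_const_mul hf, map_smul]

theorem gradient_fun_mul (hf : DifferentiableAt ℝ f x) (hg : DifferentiableAt ℝ g x) :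
    gradient (fun y => f y * g y) x = f x • gradient g x + g x • gradient f x := by
  simp only [gradient, fderiv_fun_mul hf hg, map_add, map_smul]

theorem norm_gradient (f : F → ℝ) (x : F) : ‖gradient f x‖ = ‖fderiv ℝ f x‖ :=
  LinearIsometryEquiv.norm_map _ _

end Gradient

namespace IsTestFunction

variable {U V : Set (E d)} {φ ψ : E d → ℝ}

theorem mono (hφ : IsTestFunction U φ) (hUV : U ⊆ V) : IsTestFunction V φ :=
  ⟨hφ.1, hφ.2.1, hφ.2.2.trans hUV⟩

theorem zero : IsTestFunction U (fun _ => 0) :=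
  ⟨contDiff_const, HasCompactSupport.zero, by simp⟩

theorem add (hφ : IsTestFunction U φ) (hψ : IsTestFunction U ψ) :
    IsTestFunction U (fun x => φ x + ψ x) :=
  ⟨hφ.1.add hψ.1, hφ.2.1.add hψ.2.1, (tsupport_add φ ψ).trans (union_subset hφ.2.2 hψ.2.2)⟩

theorem const_mul (c : ℝ) (hφ : IsTestFunction U φ) : IsTestFunction U (fun x => c * φ x) :=
  ⟨contDiff_const.mul hφ.1, hφ.2.1.mul_left,
    (closure_mono (Function.support_mul_subset_right (fun _ => c) φ)).trans hφ.2.2⟩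

theorem differentiable (hφ : IsTestFunction U φ) : Differentiable ℝ φ :=
  hφ.1.differentiable (by simp)

theorem eq_zero (hφ : IsTestFunction U φ) {x : E d} (hx : x ∉ U) : φ x = 0 :=
  image_eq_zero_of_notMem_tsupport fun h => hx (hφ.2.2 h)

theorem gradient_eq_zero (hφ : IsTestFunction U φ) {x : E d} (hx : x ∉ U) :
    gradient φ x = 0 := by
  have hzero : φ =ᶠ[𝓝 x] fun _ => 0 :=
    notMem_tsupport_iff_eventuallyEq.1 fun h => hx (hφ.2.2 h)
  rw [hzero.gradient_eq, gradient_fun_const]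

theorem continuous_gradient (hφ : IsTestFunction U φ) : Continuous (gradient φ) :=
  (InnerProductSpace.toDual ℝ (E d)).symm.continuous.comp (hφ.1.continuous_fderiv (by simp))

theorem hasCompactSupport_gradient (hφ : IsTestFunction U φ) :
    HasCompactSupport (gradient φ) :=
  (hφ.2.1.fderiv (𝕜 := ℝ)).comp_left (map_zero (InnerProductSpace.toDual ℝ (E d)).symm)

theorem memLp (hφ : IsTestFunction U φ) : MemLp φ 2 volume :=
  hφ.1.continuous.memLp_of_hasCompactSupport hφ.2.1

theorem memLp_gradient (hφ : IsTestFunction U φ) : MemLp (gradient φ) 2 volume :=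
  hφ.continuous_gradient.memLp_of_hasCompactSupport hφ.hasCompactSupport_gradient

theorem integrable (hφ : IsTestFunction U φ) : Integrable φ :=
  hφ.1.continuous.integrable_of_hasCompactSupport hφ.2.1

theorem integrable_norm_gradient_sq (hφ : IsTestFunction U φ) :
    Integrable (fun x => ‖gradient φ x‖ ^ 2) :=
  (memLp_two_iff_integrable_sq_norm hφ.memLp_gradient.1).1 hφ.memLp_gradient

end IsTestFunction

/-- The functional `2 ∫ f φ - ∫ |∇φ|²`, whose supremum over the test functions on `Ω \ S` is the
compliance. -/
noncomputable def energy (f φ : E d → ℝ) : ℝ := (2 * ∫ x, f x * φ x) - ∫ x, ‖gradient φ x‖ ^ 2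

/-- The Poincaré inequality `∫ φ² ≤ C ∫ |∇φ|²` for the test functions on `U`. -/
def PoincareOn (U : Set (E d)) (C : ℝ) : Prop :=
  ∀ φ, IsTestFunction U φ → ∫ x, φ x ^ 2 ≤ C * ∫ x, ‖gradient φ x‖ ^ 2

/-! ### The space `H¹₀` and the variational principle -/

section LTwo

variable {α F : Type*} [MeasurableSpace α] {μ : Measure α} [NormedAddCommGroup F]
  [InnerProductSpace ℝ F] {s : Set α} {f : α → F}

theorem norm_sq_toLp_eq_integral (hf : MemLp f 2 μ) : ‖hf.toLp f‖ ^ 2 = ∫ x, ‖f x‖ ^ 2 ∂μ := by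
  rw [← real_inner_self_eq_norm_sq, L2.inner_def]
  refine integral_congr_ae ?_
  filter_upwards [hf.coeFn_toLp] with x hx
  rw [hx, real_inner_self_eq_norm_sq]

theorem inner_toLp_indicator (hs : MeasurableSet s) (hf : MemLp (s.indicator f) 2 μ)
    (w : Lp F 2 μ) : inner ℝ (hf.toLp _) w = ∫ x in s, inner ℝ (f x) (w x) ∂μ := by
  rw [L2.inner_def, ← integral_indicator hs]
  refine integral_congr_ae ?_
  filter_upwards [hf.coeFn_toLp] with x hx
  by_cases hxs : x ∈ s <;> simp [hx, hxs]

end LTwo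

/-- The Hilbert space of pairs (function, weak gradient) of square-integrable functions. -/
abbrev PairSpace (d : ℕ) :=
  WithLp 2 (Lp ℝ 2 (volume : Measure (E d)) × Lp (E d) 2 (volume : Measure (E d)))

theorem tendsto_pairSpace_iff {k : ℕ → PairSpace d} {k₀ : PairSpace d} :
    Tendsto k atTop (𝓝 k₀) ↔ Tendsto (fun n => (k n).fst) atTop (𝓝 k₀.fst) ∧
      Tendsto (fun n => (k n).snd) atTop (𝓝 k₀.snd) := by
  refine ⟨fun h => ⟨((WithLp.fstL 2 ℝ _ _).continuous.tendsto k₀).comp h,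
    ((WithLp.sndL 2 ℝ _ _).continuous.tendsto k₀).comp h⟩, fun ⟨hfst, hsnd⟩ => ?_⟩
  exact ((WithLp.prod_continuous_toLp 2 (Lp ℝ 2 (volume : Measure (E d)))
    (Lp (E d) 2 (volume : Measure (E d)))).tendsto (k₀.fst, k₀.snd)).comp (hfst.prodMk_nhds hsnd)

/-- The pairs `(φ, ∇φ)` of test functions on `U` and their gradients. -/
noncomputable def testPairs (U : Set (E d)) : Submodule ℝ (PairSpace d) where
  carrier := {k | ∃ φ, IsTestFunction U φ ∧ k.fst =ᵐ[volume] φ ∧ k.snd =ᵐ[volume] gradient φ}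
  zero_mem' := by
    refine ⟨_, IsTestFunction.zero, Lp.coeFn_zero _ _ _, ?_⟩
    rw [gradient_fun_const']
    exact Lp.coeFn_zero _ _ _
  add_mem' := by
    rintro a b ⟨φ, hφ, ha1, ha2⟩ ⟨ψ, hψ, hb1, hb2⟩
    refine ⟨_, hφ.add hψ, ?_, ?_⟩
    · filter_upwards [Lp.coeFn_add a.fst b.fst, ha1, hb1] with x h h1 h2
      rw [WithLp.add_fst, h, Pi.add_apply, h1, h2]
    · filter_upwards [Lp.coeFn_add a.snd b.snd, ha2, hb2] with x h h1 h2
      rw [gradient_fun_add (hφ.differentiable x) (hψ.differentiable x), WithLp.add_snd, h,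
        Pi.add_apply, h1, h2]
  smul_mem' := by
    rintro c a ⟨φ, hφ, ha1, ha2⟩
    refine ⟨_, hφ.const_mul c, ?_, ?_⟩
    · filter_upwards [Lp.coeFn_smul c a.fst, ha1] with x h h1
      simp [h, h1]
    · filter_upwards [Lp.coeFn_smul c a.snd, ha2] with x h h1
      rw [gradient_fun_const_mul (hφ.differentiable x)]
      simp [h, h1]

/-- The space `H¹₀(U)`, as the closure of the test pairs in the space of pairs, whose norm
is the `H¹`-norm. -/
noncomputable def h10Space (U : Set (E d)) : Submodule ℝ (PairSpace d) :=
  (testPairs U).topologicalClosure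

section H10

variable {U S Ω : Set (E d)} {C : ℝ} {f u : E d → ℝ}

/-- The pair `(φ, ∇φ)` of a test function `φ`, as an element of the space of pairs. -/
noncomputable def IsTestFunction.pair {φ : E d → ℝ} (hφ : IsTestFunction U φ) : PairSpace d :=
  WithLp.toLp 2 (hφ.memLp.toLp φ, hφ.memLp_gradient.toLp (gradient φ))

theorem IsTestFunction.pair_fst {φ : E d → ℝ} (hφ : IsTestFunction U φ) :
    hφ.pair.fst =ᵐ[volume] φ :=
  hφ.memLp.coeFn_toLp

theorem IsTestFunction.pair_snd {φ : E d → ℝ} (hφ : IsTestFunction U φ) :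
    hφ.pair.snd =ᵐ[volume] gradient φ :=
  hφ.memLp_gradient.coeFn_toLp

theorem IsTestFunction.pair_mem {φ : E d → ℝ} (hφ : IsTestFunction U φ) : hφ.pair ∈ testPairs U :=
  ⟨φ, hφ, hφ.pair_fst, hφ.pair_snd⟩

theorem exists_eq_pair_of_mem_testPairs {k : PairSpace d} (hk : k ∈ testPairs U) :
    ∃ φ, ∃ hφ : IsTestFunction U φ, k = hφ.pair := by
  obtain ⟨φ, hφ, hfst, hsnd⟩ := hk
  exact ⟨φ, hφ, WithLp.ofLp_injective 2 <| Prod.ext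
    (Lp.ext (hfst.trans hφ.pair_fst.symm)) (Lp.ext (hsnd.trans hφ.pair_snd.symm))⟩

theorem h10Space_subset_of_isClosed {A : Set (PairSpace d)} (hA : IsClosed A)
    (h : ∀ φ, ∀ hφ : IsTestFunction U φ, hφ.pair ∈ A) : (h10Space U : Set (PairSpace d)) ⊆ A := by
  refine closure_minimal (fun k hk => ?_) hA
  obtain ⟨φ, hφ, rfl⟩ := exists_eq_pair_of_mem_testPairs hk
  exact h φ hφ

theorem mem_h10Space_iff {k : PairSpace d} :
    k ∈ h10Space U ↔ ∃ φ : ℕ → E d → ℝ, (∀ n, IsTestFunction U (φ n)) ∧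
      Tendsto (fun n => eLpNorm (fun x => φ n x - k.fst x) 2 volume) atTop (𝓝 0) ∧
      Tendsto (fun n => eLpNorm (fun x => gradient (φ n) x - k.snd x) 2 volume) atTop (𝓝 0) := by
  have htendsto : ∀ φ : ℕ → E d → ℝ, ∀ hφ : ∀ n, IsTestFunction U (φ n),
      Tendsto (fun n => (hφ n).pair) atTop (𝓝 k) ↔
      Tendsto (fun n => eLpNorm (fun x => φ n x - k.fst x) 2 volume) atTop (𝓝 0) ∧
      Tendsto (fun n => eLpNorm (fun x => gradient (φ n) x - k.snd x) 2 volume) atTop (𝓝 0) := by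
    intro φ hφ
    rw [tendsto_pairSpace_iff]
    have hfst := Lp.tendsto_Lp_iff_tendsto_eLpNorm'' (fi := atTop) φ
      (fun n => (hφ n).memLp) k.fst (Lp.memLp _)
    have hsnd := Lp.tendsto_Lp_iff_tendsto_eLpNorm'' (fi := atTop) (fun n => gradient (φ n))
      (fun n => (hφ n).memLp_gradient) k.snd (Lp.memLp _)
    rw [Lp.toLp_coeFn] at hfst hsnd
    exact and_congr hfst hsnd
  change k ∈ closure (testPairs U : Set (PairSpace d)) ↔ _
  rw [mem_closure_iff_seq_limit]
  constructor
  · rintro ⟨k', hk', hlim⟩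
    choose φ hφ hk'φ using fun n => exists_eq_pair_of_mem_testPairs (hk' n)
    obtain rfl : k' = fun n => (hφ n).pair := funext hk'φ
    exact ⟨φ, hφ, (htendsto φ hφ).1 hlim⟩
  · rintro ⟨φ, hφ, hlim⟩
    exact ⟨fun n => (hφ n).pair, fun n => (hφ n).pair_mem, (htendsto φ hφ).2 hlim⟩

theorem memH10With_iff {g : E d → E d} :
    MemH10With U u g ↔ ∃ k ∈ h10Space U, k.fst =ᵐ[volume] u ∧ k.snd =ᵐ[volume] g := by
  have hcongr : ∀ k : PairSpace d, k.fst =ᵐ[volume] u → k.snd =ᵐ[volume] g →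
      (k ∈ h10Space U ↔ ∃ φ : ℕ → E d → ℝ, (∀ n, IsTestFunction U (φ n)) ∧
        Tendsto (fun n => eLpNorm (fun x => φ n x - u x) 2 volume) atTop (𝓝 0) ∧
        Tendsto (fun n => eLpNorm (fun x => gradient (φ n) x - g x) 2 volume) atTop (𝓝 0)) := by
    intro k hku hkg
    rw [mem_h10Space_iff]
    refine exists_congr fun φ => and_congr_right fun _ => ?_
    rw [show (fun n => eLpNorm (fun x => φ n x - k.fst x) 2 volume) =
        fun n => eLpNorm (fun x => φ n x - u x) 2 volume from
          funext fun n => eLpNorm_congr_ae ((ae_eq_refl _).sub hku),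
      show (fun n => eLpNorm (fun x => gradient (φ n) x - k.snd x) 2 volume) =
        fun n => eLpNorm (fun x => gradient (φ n) x - g x) 2 volume from
          funext fun n => eLpNorm_congr_ae ((ae_eq_refl _).sub hkg)]
  constructor
  · rintro ⟨hu, hg, hlim⟩
    exact ⟨WithLp.toLp 2 (hu.toLp u, hg.toLp g),
      (hcongr (WithLp.toLp 2 (hu.toLp u, hg.toLp g)) hu.coeFn_toLp hg.coeFn_toLp).2 hlim,
      hu.coeFn_toLp, hg.coeFn_toLp⟩
  · rintro ⟨k, hk, hku, hkg⟩
    exact ⟨(memLp_congr_ae hku).1 (Lp.memLp _), (memLp_congr_ae hkg).1 (Lp.memLp _),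
      (hcongr k hku hkg).1 hk⟩

theorem memH10With_of_mem_h10Space {k : PairSpace d} (hk : k ∈ h10Space U) :
    MemH10With U k.fst k.snd :=
  memH10With_iff.2 ⟨k, hk, ae_eq_refl _, ae_eq_refl _⟩

theorem PoincareOn.norm_fst_sq_le (hC : PoincareOn U C) {k : PairSpace d} (hk : k ∈ h10Space U) :
    ‖k.fst‖ ^ 2 ≤ C * ‖k.snd‖ ^ 2 := by
  have hclosed : IsClosed {k : PairSpace d | ‖k.fst‖ ^ 2 ≤ C * ‖k.snd‖ ^ 2} :=
    isClosed_le ((WithLp.fstL 2 ℝ _ _).continuous.norm.pow 2)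
      (continuous_const.mul ((WithLp.sndL 2 ℝ _ _).continuous.norm.pow 2))
  refine h10Space_subset_of_isClosed hclosed (fun φ hφ => ?_) hk
  change ‖hφ.memLp.toLp φ‖ ^ 2 ≤ C * ‖hφ.memLp_gradient.toLp (gradient φ)‖ ^ 2
  simpa only [norm_sq_toLp_eq_integral, Real.norm_eq_abs, sq_abs] using hC φ hφ

theorem setIntegral_inner_of_mem_h10Space (hΩ : MeasurableSet Ω) (hU : U ⊆ Ω)
    (g : Lp (E d) 2 (volume : Measure (E d))) {w : PairSpace d} (hw : w ∈ h10Space U) :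
    ∫ x in Ω, inner ℝ (g x) (w.snd x) = inner ℝ g w.snd := by
  have hg : MemLp (Ω.indicator g) 2 volume := (Lp.memLp g).indicator hΩ
  rw [← inner_toLp_indicator hΩ hg]
  have hclosed : IsClosed {w : PairSpace d | inner ℝ (hg.toLp _) w.snd = inner ℝ g w.snd} :=
    isClosed_eq (continuous_const.inner (WithLp.sndL 2 ℝ _ _).continuous)
      (continuous_const.inner (WithLp.sndL 2 ℝ _ _).continuous)
  refine h10Space_subset_of_isClosed hclosed (fun φ hφ => ?_) hw
  refine integral_congr_ae ?_
  filter_upwards [hg.coeFn_toLp, hφ.pair_snd] with x hx hxφ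
  by_cases h : x ∈ Ω
  · rw [hx, indicator_of_mem h]
  · rw [hxφ, hφ.gradient_eq_zero fun hxU => h (hU hxU), inner_zero_right,
      inner_zero_right]

theorem PoincareOn.exists_weak_pair (hC : PoincareOn U C) (ℓ : Lp ℝ 2 (volume : Measure (E d))) :
    ∃ k ∈ h10Space U, ∀ w ∈ h10Space U, inner ℝ k.snd w.snd = inner ℝ ℓ w.fst := by
  have : CompleteSpace (h10Space U) :=
    (Submodule.isClosed_topologicalClosure _).completeSpace_coe
  let snd : h10Space U →L[ℝ] Lp (E d) 2 (volume : Measure (E d)) :=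
    (WithLp.sndL 2 ℝ _ _).comp (h10Space U).subtypeL
  let fst : h10Space U →L[ℝ] Lp ℝ 2 (volume : Measure (E d)) :=
    (WithLp.fstL 2 ℝ _ _).comp (h10Space U).subtypeL
  let B : h10Space U →L[ℝ] h10Space U →L[ℝ] ℝ :=
    (innerSL ℝ (E := Lp (E d) 2 (volume : Measure (E d)))).bilinearComp snd snd
  have hB : ∀ v w, B v w = inner ℝ (v : PairSpace d).snd (w : PairSpace d).snd := fun _ _ => rfl
  have hcoercive : IsCoercive B := by
    refine ⟨(1 + |C|)⁻¹, by positivity, fun v => ?_⟩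
    rw [hB, real_inner_self_eq_norm_sq, mul_assoc, inv_mul_le_iff₀ (by positivity), ← sq,
      Submodule.coe_norm, WithLp.prod_norm_sq_eq_of_L2]
    have habs := mul_le_mul_of_nonneg_right (le_abs_self C) (sq_nonneg ‖(v : PairSpace d).snd‖)
    linarith [hC.norm_fst_sq_le v.2]
  let k := hcoercive.continuousLinearEquivOfBilin.symm
    ((InnerProductSpace.toDual ℝ (h10Space U)).symm ((innerSL ℝ ℓ).comp fst))
  refine ⟨k, k.2, fun w hw => ?_⟩
  have hk := hcoercive.continuousLinearEquivOfBilin_apply k ⟨w, hw⟩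
  simp only [k, ContinuousLinearEquiv.apply_symm_apply,
    InnerProductSpace.toDual_symm_apply] at hk
  exact ((hB _ _).symm.trans hk.symm :)

theorem isWeakSolution_iff (hΩ : MeasurableSet Ω) (hf : MemLp (Ω.indicator f) 2 volume) :
    IsWeakSolution f S Ω u ↔ ∃ k ∈ h10Space (Ω \ S), k.fst =ᵐ[volume] u ∧
      ∀ w ∈ h10Space (Ω \ S), inner ℝ k.snd w.snd = inner ℝ (hf.toLp _) w.fst := by
  have hweak : ∀ k w : PairSpace d, w ∈ h10Space (Ω \ S) → ∀ g φ h, k.snd =ᵐ[volume] g →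
      w.fst =ᵐ[volume] φ → w.snd =ᵐ[volume] h →
      (inner ℝ k.snd w.snd = inner ℝ (hf.toLp _) w.fst ↔
        ∫ x in Ω, inner ℝ (g x) (h x) = ∫ x in Ω, f x * φ x) := by
    intro k w hw g φ h hg hφ hh
    rw [← setIntegral_inner_of_mem_h10Space hΩ sdiff_subset _ hw, inner_toLp_indicator hΩ hf]
    refine Eq.congr (integral_congr_ae (ae_restrict_of_ae ?_))
      (integral_congr_ae (ae_restrict_of_ae ?_))
    · filter_upwards [hg, hh] with x hgx hhx
      rw [hgx, hhx]
    · filter_upwards [hφ] with x hx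
      rw [hx, RCLike.inner_apply', conj_trivial]
  constructor
  · rintro ⟨g, hg, h⟩
    obtain ⟨k, hk, hku, hkg⟩ := memH10With_iff.1 hg
    exact ⟨k, hk, hku, fun w hw => (hweak k w hw _ _ _ hkg (ae_eq_refl _) (ae_eq_refl _)).2
      (h _ _ (memH10With_of_mem_h10Space hw))⟩
  · rintro ⟨k, hk, hku, h⟩
    refine ⟨k.snd, memH10With_iff.2 ⟨k, hk, hku, ae_eq_refl _⟩, fun φ h' hφ => ?_⟩
    obtain ⟨w, hw, hwφ, hwh⟩ := memH10With_iff.1 hφ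
    exact (hweak k w hw _ _ _ (ae_eq_refl _) hwφ hwh).1 (h w hw)

theorem PoincareOn.isWeakSolution_solution (hC : PoincareOn (Ω \ S) C) (hΩ : MeasurableSet Ω)
    (hf : MemLp (Ω.indicator f) 2 volume) : IsWeakSolution f S Ω (solution f S Ω) := by
  obtain ⟨k, hk, hweak⟩ := hC.exists_weak_pair (hf.toLp _)
  have hex : ∃ u, IsWeakSolution f S Ω u :=
    ⟨k.fst, (isWeakSolution_iff hΩ hf).2 ⟨k, hk, ae_eq_refl _, hweak⟩⟩
  rw [solution, dif_pos hex]
  exact hex.choose_spec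

/-- The energy functional `2 ⟪ℓ, u⟫ - |g|²` on pairs `(u, g)`. -/
noncomputable def pairEnergy (ℓ : Lp ℝ 2 (volume : Measure (E d))) (k : PairSpace d) : ℝ :=
  2 * inner ℝ ℓ k.fst - ‖k.snd‖ ^ 2

theorem continuous_pairEnergy (ℓ : Lp ℝ 2 (volume : Measure (E d))) :
    Continuous (pairEnergy ℓ) :=
  (continuous_const.mul (continuous_const.inner (WithLp.fstL 2 ℝ _ _).continuous)).sub
    ((WithLp.sndL 2 ℝ _ _).continuous.norm.pow 2)

theorem pairEnergy_pair (hΩ : MeasurableSet Ω) (hf : MemLp (Ω.indicator f) 2 volume)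
    {φ : E d → ℝ} (hφ : IsTestFunction (Ω \ S) φ) :
    pairEnergy (hf.toLp _) hφ.pair = energy f φ := by
  have hlin : ∫ x, f x * φ x = ∫ x in Ω, f x * φ x :=
    (setIntegral_eq_integral_of_forall_compl_eq_zero fun x hx => by
      rw [hφ.eq_zero fun h => hx h.1, mul_zero]).symm
  rw [energy, hlin, pairEnergy, inner_toLp_indicator hΩ hf,
    ← norm_sq_toLp_eq_integral hφ.memLp_gradient]
  congr 2
  refine integral_congr_ae (ae_restrict_of_ae ?_)
  filter_upwards [hφ.pair_fst] with x hx
  rw [hx, RCLike.inner_apply', conj_trivial]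

theorem pairEnergy_le_of_weak {ℓ : Lp ℝ 2 (volume : Measure (E d))} {k w : PairSpace d}
    (hkk : inner ℝ k.snd k.snd = inner ℝ ℓ k.fst) (hkw : inner ℝ k.snd w.snd = inner ℝ ℓ w.fst) :
    pairEnergy ℓ w ≤ inner ℝ ℓ k.fst := by
  have hsq := sq_nonneg ‖k.snd - w.snd‖
  rw [norm_sub_sq_real, ← real_inner_self_eq_norm_sq k.snd, hkk, hkw] at hsq
  rw [pairEnergy]
  linarith

theorem PoincareOn.isLUB_energy_compliance (hC : PoincareOn (Ω \ S) C) (hΩ : MeasurableSet Ω)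
    (hf : MemLp (Ω.indicator f) 2 volume) :
    IsLUB (energy f '' {φ | IsTestFunction (Ω \ S) φ}) (compliance S f Ω) := by
  obtain ⟨k, hk, hku, hweak⟩ :=
    (isWeakSolution_iff hΩ hf).1 (hC.isWeakSolution_solution hΩ hf)
  have hcompliance : compliance S f Ω = inner ℝ (hf.toLp _) k.fst := by
    rw [compliance, inner_toLp_indicator hΩ hf]
    refine integral_congr_ae (ae_restrict_of_ae ?_)
    filter_upwards [hku] with x hx
    rw [hx, RCLike.inner_apply', conj_trivial]
  rw [hcompliance]
  constructor
  · rintro _ ⟨φ, hφ, rfl⟩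
    rw [← pairEnergy_pair hΩ hf hφ]
    exact pairEnergy_le_of_weak (hweak k hk) (hweak _ (subset_closure hφ.pair_mem))
  · intro b hb
    have hle : pairEnergy (hf.toLp _) k ≤ b :=
      h10Space_subset_of_isClosed (isClosed_le (continuous_pairEnergy _) continuous_const)
        (fun φ hφ => (pairEnergy_pair hΩ hf hφ).trans_le (hb ⟨φ, hφ, rfl⟩)) hk
    rw [pairEnergy, ← real_inner_self_eq_norm_sq, hweak k hk] at hle
    linarith

end H10

/-! ### Poincaré inequalities -/

theorem sq_integral_mul_le {α : Type*} [MeasurableSpace α] {μ : Measure α} {f g : α → ℝ}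
    (hf : MemLp f 2 μ) (hg : MemLp g 2 μ) :
    (∫ x, f x * g x ∂μ) ^ 2 ≤ (∫ x, f x ^ 2 ∂μ) * ∫ x, g x ^ 2 ∂μ := by
  have hinner : inner ℝ (hf.toLp f) (hg.toLp g) = ∫ x, f x * g x ∂μ := by
    rw [L2.inner_def]
    refine integral_congr_ae ?_
    filter_upwards [hf.coeFn_toLp, hg.coeFn_toLp] with x hfx hgx
    rw [hfx, hgx, RCLike.inner_apply', conj_trivial]
  have hnorm : ∀ {h : α → ℝ} (hh : MemLp h 2 μ), ‖hh.toLp h‖ ^ 2 = ∫ x, h x ^ 2 ∂μ := fun hh => by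
    simp only [norm_sq_toLp_eq_integral, Real.norm_eq_abs, sq_abs]
  rw [← hinner, ← hnorm hf, ← hnorm hg, ← mul_pow, ← sq_abs]
  exact pow_le_pow_left₀ (abs_nonneg _) (abs_real_inner_le_norm _ _) 2

theorem sq_le_mul_setIntegral_sq_of_hasDerivAt {f f' : ℝ → ℝ} (hf : ∀ s, HasDerivAt f (f' s) s)
    (hf' : Continuous f') {L t : ℝ} (ht : |t| ≤ L) (hft : f t = 0) :
    f 0 ^ 2 ≤ L * ∫ s in Ioc (-L) L, f' s ^ 2 := by
  have hsub : uIoc t 0 ⊆ Ioc (-L) L := by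
    intro s hs
    obtain ⟨htl, htr⟩ := abs_le.1 ht
    rcases mem_uIoc.1 hs with ⟨hl, hr⟩ | ⟨hl, hr⟩ <;> constructor <;> linarith
  have hint : f 0 = ∫ s in t..0, f' s := by
    rw [intervalIntegral.integral_eq_sub_of_hasDerivAt (fun s _ => hf s)
      (hf'.intervalIntegrable _ _), hft, sub_zero]
  have hsq : IntegrableOn (fun s => f' s ^ 2) (Ioc (-L) L) :=
    (hf'.pow 2).continuousOn.integrableOn_Icc.mono_set Ioc_subset_Icc_self
  have : IsFiniteMeasure (volume.restrict (uIoc t 0)) := ⟨by simp [Real.volume_uIoc]⟩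
  have hcs := sq_integral_mul_le (μ := volume.restrict (uIoc t 0)) (memLp_const (1 : ℝ))
    ((memLp_two_iff_integrable_sq hf'.aestronglyMeasurable).2 (hsq.mono_set hsub))
  simp only [one_mul, one_pow, setIntegral_const, smul_eq_mul, mul_one, measureReal_def,
    Real.volume_uIoc, zero_sub, abs_neg, ENNReal.toReal_ofReal (abs_nonneg t)] at hcs
  calc f 0 ^ 2 = (∫ s in uIoc t 0, f' s) ^ 2 := by
        rw [hint, ← sq_abs, intervalIntegral.abs_intervalIntegral_eq, sq_abs]
    _ ≤ |t| * ∫ s in uIoc t 0, f' s ^ 2 := hcs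
    _ ≤ L * ∫ s in Ioc (-L) L, f' s ^ 2 :=
        mul_le_mul ht (setIntegral_mono_set hsq (ae_of_all _ fun s => sq_nonneg _)
          hsub.eventuallyLE) (integral_nonneg fun s => sq_nonneg _) ((abs_nonneg t).trans ht)

section Translation

variable {F : Type*} [NormedAddCommGroup F] [NormedSpace ℝ F] [FiniteDimensional ℝ F]
  [MeasurableSpace F] [BorelSpace F] {μ : Measure F} [μ.IsAddHaarMeasure] {ν : Measure ℝ}
  [IsFiniteMeasure ν] {g : F → ℝ}

theorem integrable_prod_add_smul (hg : Continuous g) (hgi : Integrable g μ) (e : F) :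
    Integrable (fun z : F × ℝ => g (z.1 + z.2 • e)) (μ.prod ν) := by
  have hmeas : AEStronglyMeasurable (fun z : F × ℝ => g (z.1 + z.2 • e)) (μ.prod ν) :=
    (hg.comp (by fun_prop)).aestronglyMeasurable
  refine (integrable_prod_iff' hmeas).2 ⟨ae_of_all _ fun s => hgi.comp_add_right (s • e), ?_⟩
  simp only [integral_add_right_eq_self (fun x => ‖g x‖)]
  exact integrable_const _

theorem integral_integral_add_smul (hg : Continuous g) (hgi : Integrable g μ) (e : F) :
    ∫ x, ∫ s, g (x + s • e) ∂ν ∂μ = ν.real univ * ∫ x, g x ∂μ := by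
  rw [integral_integral_swap (integrable_prod_add_smul hg hgi e)]
  simp only [integral_add_right_eq_self g, integral_const, smul_eq_mul]

end Translation

section Poincare

variable {U V S Ω : Set (E d)} {C L : ℝ} {f : E d → ℝ} {e : E d}

theorem IsTestFunction.sq_le_mul_setIntegral_gradient {φ : E d → ℝ} (hφ : IsTestFunction U φ)
    (he : ‖e‖ = 1) {x : E d} {t : ℝ} (ht : |t| ≤ L) (hx : φ (x + t • e) = 0) :
    φ x ^ 2 ≤ L * ∫ s in Ioc (-L) L, ‖gradient φ (x + s • e)‖ ^ 2 := by
  have hgrad : Continuous fun s : ℝ => gradient φ (x + s • e) :=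
    hφ.continuous_gradient.comp (by fun_prop)
  have hinner : Continuous fun s : ℝ => inner ℝ (gradient φ (x + s • e)) e :=
    hgrad.inner continuous_const
  have hderiv : ∀ s : ℝ, HasDerivAt (fun s : ℝ => φ (x + s • e))
      (inner ℝ (gradient φ (x + s • e)) e) s := by
    intro s
    have hline : HasDerivAt (fun s : ℝ => x + s • e) e s := by
      simpa only [id, one_smul] using ((hasDerivAt_id s).smul_const e).const_add x
    rw [inner_gradient_left]
    exact (hφ.differentiable (x + s • e)).hasFDerivAt.comp_hasDerivAt s hline
  have hline := sq_le_mul_setIntegral_sq_of_hasDerivAt hderiv hinner ht hx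
  rw [zero_smul, add_zero] at hline
  refine hline.trans (mul_le_mul_of_nonneg_left ?_ ((abs_nonneg t).trans ht))
  refine setIntegral_mono
    ((hinner.pow 2).continuousOn.integrableOn_Icc.mono_set Ioc_subset_Icc_self)
    ((hgrad.norm.pow 2).continuousOn.integrableOn_Icc.mono_set Ioc_subset_Icc_self) fun s => ?_
  simpa only [he, mul_one, sq_abs] using pow_le_pow_left₀ (abs_nonneg _)
    (abs_real_inner_le_norm (gradient φ (x + s • e)) e) 2

theorem PoincareOn.mono (hV : PoincareOn V C) (hUV : U ⊆ V) : PoincareOn U C :=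
  fun φ hφ => hV φ (hφ.mono hUV)

theorem poincareOn_of_forall_exists_notMem (he : ‖e‖ = 1) (hL : 0 ≤ L)
    (h : ∀ x ∈ U, ∃ t : ℝ, |t| ≤ L ∧ x + t • e ∉ U) : PoincareOn U (2 * L ^ 2) := by
  intro φ hφ
  have hcont : Continuous fun x => ‖gradient φ x‖ ^ 2 := hφ.continuous_gradient.norm.pow 2
  have hint := hφ.integrable_norm_gradient_sq
  calc ∫ x, φ x ^ 2
      ≤ ∫ x, L * ∫ s in Ioc (-L) L, ‖gradient φ (x + s • e)‖ ^ 2 := by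
        refine integral_mono hφ.memLp.integrable_sq
          ((integrable_prod_add_smul hcont hint e).integral_prod_left.const_mul _) fun x => ?_
        by_cases hx : x ∈ U
        · obtain ⟨t, ht, hxt⟩ := h x hx
          exact hφ.sq_le_mul_setIntegral_gradient he ht (hφ.eq_zero hxt)
        · rw [hφ.eq_zero hx, zero_pow two_ne_zero]
          exact mul_nonneg hL (integral_nonneg fun s => sq_nonneg _)
    _ = 2 * L ^ 2 * ∫ x, ‖gradient φ x‖ ^ 2 := by
        rw [integral_const_mul, integral_integral_add_smul hcont hint,
          measureReal_restrict_apply_univ, Real.volume_real_Ioc_of_le (by linarith)]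
        ring

section Bounded

variable [NeZero d]

theorem exists_poincareOn_of_isBounded (hU : Bornology.IsBounded U) : ∃ C, PoincareOn U C := by
  obtain ⟨R, hR, hUR⟩ := hU.subset_ball_lt 0 0
  have he : ‖(EuclideanSpace.single 0 1 : E d)‖ = 1 := by simp
  refine ⟨_, poincareOn_of_forall_exists_notMem he (mul_nonneg zero_le_two hR.le) fun x hx =>
    ⟨2 * R, (abs_of_pos (by positivity)).le, fun hmem => ?_⟩⟩
  have hx' := mem_ball_zero_iff.1 (hUR hx)
  have hmem' := mem_ball_zero_iff.1 (hUR hmem)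
  have hnorm := norm_sub_le (x + (2 * R) • (EuclideanSpace.single 0 1 : E d)) x
  rw [add_sub_cancel_left, norm_smul, he, mul_one, Real.norm_of_nonneg (by positivity)] at hnorm
  linarith

theorem isLUB_energy_compliance (hb : Bornology.IsBounded Ω) (hΩ : MeasurableSet Ω)
    (hf : MemLp (Ω.indicator f) 2 volume) :
    IsLUB (energy f '' {φ | IsTestFunction (Ω \ S) φ}) (compliance S f Ω) := by
  obtain ⟨C, hC⟩ := exists_poincareOn_of_isBounded hb
  exact (hC.mono sdiff_subset).isLUB_energy_compliance hΩ hf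

theorem energy_le_compliance (hb : Bornology.IsBounded Ω) (hΩ : MeasurableSet Ω)
    (hf : MemLp (Ω.indicator f) 2 volume) {φ : E d → ℝ} (hφ : IsTestFunction (Ω \ S) φ) :
    energy f φ ≤ compliance S f Ω :=
  (isLUB_energy_compliance hb hΩ hf).1 ⟨φ, hφ, rfl⟩

theorem compliance_nonneg (hb : Bornology.IsBounded Ω) (hΩ : MeasurableSet Ω)
    (hf : MemLp (Ω.indicator f) 2 volume) : 0 ≤ compliance S f Ω := by
  refine le_of_eq_of_le ?_ (energy_le_compliance hb hΩ hf IsTestFunction.zero)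
  simp [energy, gradient_fun_const]

end Bounded

theorem PoincareOn.compliance_le (hC : PoincareOn (Ω \ S) C) (hC0 : 0 ≤ C)
    (hΩ : MeasurableSet Ω) (hf : MemLp (Ω.indicator f) 2 volume) :
    compliance S f Ω ≤ C * ∫ x in Ω, f x ^ 2 := by
  refine (hC.isLUB_energy_compliance hΩ hf).2 ?_
  rintro _ ⟨φ, hφ, rfl⟩
  have hindicator : ∀ x, Ω.indicator f x * φ x = f x * φ x := fun x => by
    by_cases hx : x ∈ Ω
    · rw [indicator_of_mem hx]
    · rw [hφ.eq_zero fun h => hx h.1, mul_zero, mul_zero]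
  have hcs := sq_integral_mul_le hf hφ.memLp
  have hindicator_sq : ∫ x, Ω.indicator f x ^ 2 = ∫ x in Ω, f x ^ 2 := by
    rw [← integral_indicator hΩ]
    exact integral_congr_ae (ae_of_all _ fun x => by by_cases hx : x ∈ Ω <;> simp [hx])
  simp only [hindicator, hindicator_sq] at hcs
  set A := ∫ x in Ω, f x ^ 2
  set G := ∫ x, ‖gradient φ x‖ ^ 2
  have hA : 0 ≤ A := integral_nonneg fun x => sq_nonneg _
  have hG : 0 ≤ G := integral_nonneg fun x => sq_nonneg _
  have hsq : (2 * ∫ x, f x * φ x) ^ 2 ≤ (C * A + G) ^ 2 := by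
    nlinarith [mul_le_mul_of_nonneg_left (hC φ hφ) hA, sq_nonneg (C * A - G)]
  have habs := le_of_abs_le
    (abs_le_of_sq_le_sq hsq (add_nonneg (mul_nonneg hC0 hA) hG))
  rw [energy]
  linarith

end Poincare

/-! ### Cut-off functions with a sharp Lipschitz constant -/

section Smoothing

open scoped NNReal

variable {F : Type*} [NormedAddCommGroup F] {K : ℝ≥0}

theorem exists_lipschitzWith_eq_zero_eq_one {X : Type*} [PseudoMetricSpace X] {A B : Set X} {ρ : ℝ}
    (hAB : ∀ x ∈ A, ∀ y ∉ B, ρ ≤ dist x y) (hK : 1 < K * ρ) :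
    ∃ δ > 0, ∃ f : X → ℝ, LipschitzWith K f ∧ (∀ x, f x ∈ Icc (0 : ℝ) 1) ∧
      (∀ x ∈ A, ∀ y, dist x y < 2 * δ → f y = 0) ∧ ∀ x ∉ B, ∀ y, dist x y < 2 * δ → f y = 1 := by
  have hK0 : 0 < K := pos_iff_ne_zero.2 fun h => by simp [h] at hK; linarith
  have hKinv : (0 : ℝ) < (K⁻¹ : ℝ≥0) := NNReal.coe_pos.2 (inv_pos.2 hK0)
  have hKρ : ((K⁻¹ : ℝ≥0) : ℝ) < ρ := by
    rw [NNReal.coe_inv, inv_lt_iff_one_lt_mul₀' (NNReal.coe_pos.2 hK0)]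
    exact hK
  set δ : ℝ := (ρ - (K⁻¹ : ℝ≥0)) / 4 with hδ
  refine ⟨δ, by linarith, fun x => thickenedIndicator hKinv (Metric.thickening (2 * δ) Bᶜ) x, ?_,
    fun x => ⟨NNReal.coe_nonneg _, thickenedIndicator_le_one hKinv _ x⟩, fun x hx y hxy => ?_,
    fun x hx y hxy => ?_⟩
  · have h := lipschitzWith_thickenedIndicator hKinv (Metric.thickening (2 * δ) Bᶜ)
    rwa [Real.toNNReal_coe, inv_inv] at h
  · refine NNReal.coe_eq_zero.2 (thickenedIndicator_zero hKinv _ fun hy => ?_)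
    obtain ⟨z, hz, hyz⟩ := Metric.mem_thickening_iff.1
      (Metric.thickening_thickening_subset _ _ _ hy)
    linarith [hAB x hx z hz, dist_triangle x y z]
  · exact NNReal.coe_eq_one.2 (thickenedIndicator_one hKinv _
      (Metric.mem_thickening_iff.2 ⟨x, hx, by rwa [dist_comm]⟩))

open scoped Convolution in
theorem lipschitzWith_convolution_left [MeasurableSpace F] [BorelSpace F] {μ : Measure F}
    [IsFiniteMeasureOnCompacts μ] {k f : F → ℝ} (hk : Continuous k) (hkc : HasCompactSupport k)
    (hk0 : ∀ x, 0 ≤ k x) (hk1 : ∫ x, k x ∂μ = 1) (hf : LipschitzWith K f) :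
    LipschitzWith K (k ⋆[ContinuousLinearMap.lsmul ℝ ℝ, μ] f) := by
  have hint : ∀ x : F, Integrable (fun t => k t * f (x - t)) μ := fun x =>
    (hk.mul (hf.continuous.comp (by fun_prop))).integrable_of_hasCompactSupport hkc.mul_right
  have hki : Integrable k μ := hk.integrable_of_hasCompactSupport hkc
  refine LipschitzWith.of_dist_le_mul fun x y => ?_
  simp only [convolution_def, ContinuousLinearMap.lsmul_apply, smul_eq_mul]
  rw [Real.dist_eq, ← Real.norm_eq_abs, ← integral_sub (hint x) (hint y)]
  calc ‖∫ t, k t * f (x - t) - k t * f (y - t) ∂μ‖ ≤ ∫ t, k t * (K * dist x y) ∂μ := by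
        refine norm_integral_le_of_norm_le (hki.mul_const _) (ae_of_all _ fun t => ?_)
        rw [← mul_sub, norm_mul, Real.norm_of_nonneg (hk0 t), ← dist_eq_norm,
          ← dist_sub_right x y t]
        exact mul_le_mul_of_nonneg_left (hf.dist_le_mul _ _) (hk0 t)
    _ = K * dist x y := by rw [integral_mul_const, hk1, one_mul]

variable [NormedSpace ℝ F]

/-- A smooth function with values in `[0, 1]` and Lipschitz constant `K` that vanishes near each
point of `A` and is equal to `1` near each point outside `B`. -/
structure IsCutoff (A B : Set F) (K : ℝ≥0) (ζ : F → ℝ) : Prop where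
  contDiff : ContDiff ℝ ∞ ζ
  lipschitzWith : LipschitzWith K ζ
  mem_Icc : ∀ x, ζ x ∈ Icc (0 : ℝ) 1
  eventuallyEq_zero : ∀ x ∈ A, ζ =ᶠ[𝓝 x] fun _ => 0
  eventuallyEq_one : ∀ x ∉ B, ζ =ᶠ[𝓝 x] fun _ => 1

variable [FiniteDimensional ℝ F]

theorem exists_contDiff_lipschitzWith {f : F → ℝ} (hf : LipschitzWith K f) {δ : ℝ} (hδ : 0 < δ) :
    ∃ g : F → ℝ, ContDiff ℝ ∞ g ∧ LipschitzWith K g ∧ ∀ x c ε,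
      MapsTo f (Metric.ball x δ) (Metric.closedBall c ε) → g x ∈ Metric.closedBall c ε := by
  borelize F
  let μ : Measure F := Measure.addHaar
  let ρ : ContDiffBump (0 : F) := ⟨δ / 2, δ, half_pos hδ, half_lt_self hδ⟩
  refine ⟨convolution (ρ.normed μ) f (ContinuousLinearMap.lsmul ℝ ℝ) μ,
    ρ.hasCompactSupport_normed.contDiff_convolution_left _ ρ.contDiff_normed
      hf.continuous.locallyIntegrable,
    lipschitzWith_convolution_left ρ.continuous_normed ρ.hasCompactSupport_normed
      ρ.nonneg_normed ρ.integral_normed hf, fun x c ε h => ?_⟩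
  exact dist_convolution_le (dist_nonneg.trans (h (Metric.mem_ball_self hδ)))
    ρ.support_normed_eq.subset ρ.nonneg_normed ρ.integral_normed
    hf.continuous.aestronglyMeasurable fun y hy => h hy

theorem exists_isCutoff {A B : Set F} {ρ : ℝ} (hAB : ∀ x ∈ A, ∀ y ∉ B, ρ ≤ dist x y)
    (hK : 1 < K * ρ) : ∃ ζ, IsCutoff A B K ζ := by
  -- Constancy on `2 δ`-balls around the points of `A` and `Bᶜ` survives mollification.
  obtain ⟨δ, hδ0, f, hfK, hf01, hf0, hf1⟩ := exists_lipschitzWith_eq_zero_eq_one hAB hK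
  obtain ⟨ζ, hζ, hζK, hζf⟩ := exists_contDiff_lipschitzWith hfK hδ0
  have hζ_const : ∀ c x, (∀ y, dist x y < 2 * δ → f y = c) → ζ =ᶠ[𝓝 x] fun _ => c := by
    intro c x h
    filter_upwards [Metric.ball_mem_nhds x hδ0] with x' hx'
    rw [← Set.mem_singleton_iff, ← Metric.closedBall_zero]
    refine hζf x' c 0 fun y hy => ?_
    rw [Metric.mem_ball, dist_comm] at hx' hy
    rw [h y (by linarith [dist_triangle x x' y])]
    exact Metric.mem_closedBall_self le_rfl
  refine ⟨ζ, hζ, hζK, fun x => ?_, fun x hx => hζ_const 0 x (hf0 x hx),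
    fun x hx => hζ_const 1 x (hf1 x hx)⟩
  have hball : Icc (0 : ℝ) 1 = Metric.closedBall (1 / 2) (1 / 2) := by
    rw [Real.closedBall_eq_Icc]
    norm_num
  rw [hball] at hf01 ⊢
  exact hζf x _ _ fun y _ => hf01 y

end Smoothing

namespace IsCutoff

variable {A B Ω : Set (E d)} {K : NNReal} {ζ χ : E d → ℝ}

theorem subset (hζ : IsCutoff A B K ζ) : A ⊆ B := by
  intro x hx
  by_contra hxB
  have h := (hζ.eventuallyEq_zero x hx).eq_of_nhds.symm.trans (hζ.eventuallyEq_one x hxB).eq_of_nhds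
  exact zero_ne_one h

theorem differentiable (hζ : IsCutoff A B K ζ) : Differentiable ℝ ζ :=
  hζ.contDiff.differentiable (by simp)

theorem tsupport_subset (hζ : IsCutoff A B K ζ) : tsupport ζ ⊆ Aᶜ := fun x hx hxA =>
  notMem_tsupport_iff_eventuallyEq.2 (hζ.eventuallyEq_zero x hxA) hx

theorem norm_gradient_le (hζ : IsCutoff A B K ζ) (x : E d) : ‖gradient ζ x‖ ≤ K := by
  rw [norm_gradient]
  exact norm_fderiv_le_of_lipschitz ℝ hζ.lipschitzWith

theorem gradient_eq_zero (hζ : IsCutoff A B K ζ) {x : E d} (hx : x ∉ B \ A) :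
    gradient ζ x = 0 := by
  by_cases hxA : x ∈ A
  · rw [(hζ.eventuallyEq_zero x hxA).gradient_eq, gradient_fun_const]
  · rw [(hζ.eventuallyEq_one x fun hxB => hx ⟨hxB, hxA⟩).gradient_eq, gradient_fun_const]

theorem isTestFunction_mul (hζ : IsCutoff A B K ζ) (hχ : IsTestFunction Ω χ) :
    IsTestFunction (Ω \ A) fun x => ζ x * χ x :=
  ⟨hζ.contDiff.mul hχ.1, hχ.2.1.mul_left, fun _ hx =>
    ⟨hχ.2.2 (tsupport_mul_subset_right hx), hζ.tsupport_subset (tsupport_mul_subset_left hx)⟩⟩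

end IsCutoff

theorem exists_isTestFunction_le_integral {U : Set (E d)} (hU : IsOpen U)
    (hb : Bornology.IsBounded U) {c : ℝ} (hc : c < volume.real U) :
    ∃ χ, IsTestFunction U χ ∧ (∀ x, χ x ∈ Icc (0 : ℝ) 1) ∧ c ≤ ∫ x, χ x := by
  obtain ⟨Q, hQU, hQ, hcQ⟩ : ∃ Q ⊆ U, IsCompact Q ∧ c ≤ volume.real Q := by
    rcases lt_or_ge c 0 with hc0 | hc0
    · exact ⟨∅, empty_subset U, isCompact_empty, hc0.le.trans measureReal_nonneg⟩
    · obtain ⟨Q, hQU, hQ, hcQ⟩ := hU.exists_lt_isCompact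
        ((ENNReal.ofReal_lt_iff_lt_toReal hc0 hb.measure_lt_top.ne).2 hc)
      exact ⟨Q, hQU, hQ, (ENNReal.ofReal_le_iff_le_toReal hQ.measure_lt_top.ne).1 hcQ.le⟩
  obtain ⟨ρ, hρ, hdist⟩ := Metric.exists_pos_forall_lt_edist hQ hU.isClosed_compl
    (disjoint_compl_right_iff_subset.2 hQU)
  obtain ⟨χ, hχ⟩ : ∃ χ, IsCutoff Uᶜ Qᶜ (2 / ρ) χ := by
    refine exists_isCutoff (ρ := ρ) (fun x hx y hy => ?_) ?_
    · have h := (hdist y (not_not.1 hy) x hx).le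
      rwa [edist_nndist, ENNReal.coe_le_coe, nndist_comm, ← NNReal.coe_le_coe] at h
    · rw [NNReal.coe_div, div_mul_cancel₀ _ (NNReal.coe_pos.2 hρ).ne']
      exact one_lt_two
  have hsupp : tsupport χ ⊆ U := hχ.tsupport_subset.trans (compl_compl U).subset
  have htest : IsTestFunction U χ := ⟨hχ.contDiff, Metric.isCompact_of_isClosed_isBounded
    (isClosed_tsupport χ) (hb.subset hsupp), hsupp⟩
  refine ⟨χ, htest, hχ.mem_Icc, ?_⟩
  calc c ≤ ∫ x, Q.indicator 1 x := by rwa [integral_indicator_one hQ.measurableSet]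
    _ ≤ ∫ x, χ x := by
      refine integral_mono ((integrable_indicator_iff hQ.measurableSet).2
        (integrableOn_const hQ.measure_lt_top.ne)) htest.integrable fun x => ?_
      refine indicator_le' (fun x hx => ?_) (fun x _ => (hχ.mem_Icc x).1) x
      exact (hχ.eventuallyEq_one x (not_not.2 hx)).eq_of_nhds.ge

/-! ### Comparison of the compliances of two obstacles -/

theorem norm_add_add_sq_le {F : Type*} [NormedAddCommGroup F] [InnerProductSpace ℝ F]
    {a b : F} (hab : inner ℝ a b = 0) (c : F) {η : ℝ} (hη : 0 < η) :
    ‖a + b + c‖ ^ 2 ≤ (1 + η) * (‖a‖ ^ 2 + ‖b‖ ^ 2) + (1 + η⁻¹) * ‖c‖ ^ 2 := by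
  have hpyth : ‖a + b‖ ^ 2 = ‖a‖ ^ 2 + ‖b‖ ^ 2 := by rw [norm_add_sq_real, hab]; ring
  rw [norm_add_sq_real, ← hpyth]
  linarith [real_inner_le_norm (a + b) c, two_mul_le_add_mul_sq (a := ‖a + b‖) (b := ‖c‖) hη]

namespace IsCutoff

variable {A B Ω : Set (E d)} {K : NNReal} {ζ φ χ : E d → ℝ} {h η : ℝ}

theorem norm_gradient_add_mul_sq_le (hζ : IsCutoff A B K ζ) (hφ : IsTestFunction (Ω \ B) φ)
    (hχ : IsTestFunction Ω χ) (hχh : ∀ x, χ x ∈ Icc 0 h) (hη : 0 < η) (x : E d) :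
    ‖gradient (fun y => φ y + ζ y * χ y) x‖ ^ 2 ≤
      (1 + η) * (‖gradient φ x‖ ^ 2 + (B \ A).indicator (fun _ => (h * K) ^ 2) x) +
        (1 + η⁻¹) * ‖gradient χ x‖ ^ 2 := by
  have hgrad : gradient (fun y => φ y + ζ y * χ y) x =
      gradient φ x + χ x • gradient ζ x + ζ x • gradient χ x := by
    rw [gradient_fun_add hφ.differentiable.differentiableAt
        (hζ.differentiable.fun_mul hχ.differentiable).differentiableAt,
      gradient_fun_mul hζ.differentiable.differentiableAt hχ.differentiable.differentiableAt]
    abel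
  have horth : inner ℝ (gradient φ x) (χ x • gradient ζ x) = 0 := by
    by_cases hx : x ∈ B \ A
    · rw [hφ.gradient_eq_zero fun hxB => hxB.2 hx.1, inner_zero_left]
    · rw [hζ.gradient_eq_zero hx, smul_zero, inner_zero_right]
  have hslope : ‖χ x • gradient ζ x‖ ^ 2 ≤ (B \ A).indicator (fun _ => (h * K) ^ 2) x := by
    by_cases hx : x ∈ B \ A
    · rw [indicator_of_mem hx, norm_smul, Real.norm_of_nonneg (hχh x).1]
      exact pow_le_pow_left₀ (mul_nonneg (hχh x).1 (norm_nonneg _)) (mul_le_mul (hχh x).2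
        (hζ.norm_gradient_le x) (norm_nonneg _) ((hχh x).1.trans (hχh x).2)) 2
    · simp [hζ.gradient_eq_zero hx, hx]
  have hprofile : ‖ζ x • gradient χ x‖ ^ 2 ≤ ‖gradient χ x‖ ^ 2 := by
    rw [norm_smul, Real.norm_of_nonneg (hζ.mem_Icc x).1]
    exact pow_le_pow_left₀ (mul_nonneg (hζ.mem_Icc x).1 (norm_nonneg _))
      (mul_le_of_le_one_left (norm_nonneg _) (hζ.mem_Icc x).2) 2
  rw [hgrad]
  refine (norm_add_add_sq_le horth _ hη).trans ?_
  gcongr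

theorem integral_norm_gradient_add_mul_sq_le (hζ : IsCutoff A B K ζ)
    (hAB : MeasurableSet (B \ A)) (hAB' : volume (B \ A) ≠ ⊤) (hφ : IsTestFunction (Ω \ B) φ)
    (hχ : IsTestFunction Ω χ) (hχh : ∀ x, χ x ∈ Icc 0 h) (hη : 0 < η) :
    ∫ x, ‖gradient (fun y => φ y + ζ y * χ y) x‖ ^ 2 ≤
      (1 + η) * ((∫ x, ‖gradient φ x‖ ^ 2) + (h * K) ^ 2 * volume.real (B \ A)) +
        (1 + η⁻¹) * ∫ x, ‖gradient χ x‖ ^ 2 := by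
  have hind : Integrable ((B \ A).indicator fun _ => (h * (K : ℝ)) ^ 2) :=
    (integrable_indicator_iff hAB).2 (integrableOn_const hAB')
  have hsum : Integrable fun x =>
      (1 + η) * (‖gradient φ x‖ ^ 2 + (B \ A).indicator (fun _ => (h * (K : ℝ)) ^ 2) x) :=
    (hφ.integrable_norm_gradient_sq.add hind).const_mul (1 + η)
  have hχi := hχ.integrable_norm_gradient_sq.const_mul (1 + η⁻¹)
  have htest : IsTestFunction Ω fun y => φ y + ζ y * χ y :=
    (hφ.mono sdiff_subset).add ((hζ.isTestFunction_mul hχ).mono sdiff_subset)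
  calc ∫ x, ‖gradient (fun y => φ y + ζ y * χ y) x‖ ^ 2
      ≤ ∫ x, ((1 + η) * (‖gradient φ x‖ ^ 2 + (B \ A).indicator (fun _ => (h * K) ^ 2) x) +
          (1 + η⁻¹) * ‖gradient χ x‖ ^ 2) :=
        integral_mono htest.integrable_norm_gradient_sq (hsum.add hχi)
          (hζ.norm_gradient_add_mul_sq_le hφ hχ hχh hη)
    _ = _ := by
        rw [integral_add hsum hχi, integral_const_mul, integral_const_mul,
          integral_add hφ.integrable_norm_gradient_sq hind, integral_indicator hAB,
          setIntegral_const, smul_eq_mul, mul_comm (volume.real _)]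

theorem sub_le_integral_mul (hζ : IsCutoff A B K ζ) (hB : MeasurableSet B) (hB' : volume B ≠ ⊤)
    (hχ : IsTestFunction Ω χ) (hχh : ∀ x, χ x ∈ Icc 0 h) :
    (∫ x, χ x) - h * volume.real B ≤ ∫ x, ζ x * χ x := by
  have hind : Integrable (B.indicator fun _ => h) :=
    (integrable_indicator_iff hB).2 (integrableOn_const hB')
  calc (∫ x, χ x) - h * volume.real B = ∫ x, (χ x - B.indicator (fun _ => h) x) := by
        rw [integral_sub hχ.integrable hind, integral_indicator hB, setIntegral_const, smul_eq_mul,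
          mul_comm h]
    _ ≤ ∫ x, ζ x * χ x := by
        refine integral_mono (hχ.integrable.sub hind) (hζ.isTestFunction_mul hχ).integrable
          fun x => ?_
        by_cases hx : x ∈ B
        · simp only [indicator_of_mem hx]
          linarith [(hχh x).2, mul_nonneg (hζ.mem_Icc x).1 (hχh x).1]
        · simp only [indicator_of_notMem hx, (hζ.eventuallyEq_one x hx).eq_of_nhds]
          linarith

end IsCutoff

theorem memLp_indicator_one {Ω : Set (E d)} (hb : Bornology.IsBounded Ω) (hΩ : MeasurableSet Ω) :
    MemLp (Ω.indicator fun _ => (1 : ℝ)) 2 volume :=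
  memLp_indicator_const 2 hΩ 1 (Or.inr hb.measure_lt_top.ne)

-- Adding `ζ χ` to a competitor outside `B` yields a competitor outside `A`, and the two gradients
-- are orthogonal up to the contribution of `∇χ`.
theorem IsCutoff.add_le_compliance [NeZero d] {A B Ω : Set (E d)} {K : NNReal} {ζ χ : E d → ℝ}
    {h η : ℝ} (hζ : IsCutoff A B K ζ) (hA : MeasurableSet A) (hB : MeasurableSet B)
    (hB' : volume B ≠ ⊤) (hb : Bornology.IsBounded Ω) (hΩ : MeasurableSet Ω)
    (hχ : IsTestFunction Ω χ) (hχh : ∀ x, χ x ∈ Icc 0 h) (hη : 0 < η) :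
    (1 + η)⁻¹ * compliance B (fun _ => 1) Ω + 2 * ((∫ x, χ x) - h * volume.real B)
        - (1 + η) * ((h * K) ^ 2 * volume.real (B \ A)) - (1 + η⁻¹) * ∫ x, ‖gradient χ x‖ ^ 2
      ≤ compliance A (fun _ => 1) Ω := by
  have hη' : 0 < 1 + η := by linarith
  suffices hsup : compliance B (fun _ => 1) Ω ≤ (1 + η) * (compliance A (fun _ => 1) Ω
      - 2 * ((∫ x, χ x) - h * volume.real B) + (1 + η) * ((h * K) ^ 2 * volume.real (B \ A))
      + (1 + η⁻¹) * ∫ x, ‖gradient χ x‖ ^ 2) by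
    rw [← inv_mul_le_iff₀ hη'] at hsup
    linarith
  refine (isLUB_energy_compliance hb hΩ (memLp_indicator_one hb hΩ)).2 ?_
  rintro _ ⟨ψ, hψ, rfl⟩
  have hφ := hψ.const_mul (1 + η)⁻¹
  have hζχ := hζ.isTestFunction_mul hχ
  have hcompetitor := energy_le_compliance hb hΩ (memLp_indicator_one hb hΩ)
    ((hφ.mono (sdiff_subset_sdiff_right hζ.subset)).add hζχ)
  have hgrad := hζ.integral_norm_gradient_add_mul_sq_le (hB.diff hA)
    (measure_ne_top_of_subset sdiff_subset hB') hφ hχ hχh hη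
  have hmass := hζ.sub_le_integral_mul hB hB' hχ hχh
  simp only [energy, one_mul, integral_add hφ.integrable hζχ.integrable, integral_const_mul]
    at hcompetitor
  have hscale : ∀ x, ‖gradient (fun y => (1 + η)⁻¹ * ψ y) x‖ ^ 2 =
      ((1 + η)⁻¹) ^ 2 * ‖gradient ψ x‖ ^ 2 := fun x => by
    rw [gradient_fun_const_mul hψ.differentiable.differentiableAt, norm_smul, mul_pow,
      Real.norm_of_nonneg (inv_nonneg.2 hη'.le)]
  simp only [hscale, integral_const_mul] at hgrad
  have henergy : energy (fun _ => 1) ψ = (1 + η) * (2 * ((1 + η)⁻¹ * ∫ x, ψ x) -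
      (1 + η) * (((1 + η)⁻¹) ^ 2 * ∫ x, ‖gradient ψ x‖ ^ 2)) := by
    simp only [energy, one_mul]
    field_simp
  rw [henergy]
  refine mul_le_mul_of_nonneg_left ?_ hη'.le
  linarith

/-! ### Unions of balls as obstacles -/

theorem compliance_congr {S T Ω : Set (E d)} (h : Ω \ S = Ω \ T) (f : E d → ℝ) :
    compliance S f Ω = compliance T f Ω := by
  have hweak : IsWeakSolution f S Ω = IsWeakSolution f T Ω := by
    ext u
    rw [IsWeakSolution, IsWeakSolution, h]
  simp only [compliance, solution]
  rw [hweak]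

section BallUnion

variable {ι : Type*}

/-- The union of the closed balls of radius `r` centred at the points `x i`. -/
def ballUnion (x : ι → E d) (r : ℝ) : Set (E d) := ⋃ i, Metric.closedBall (x i) r

theorem mem_ballUnion {x : ι → E d} {r : ℝ} {y : E d} :
    y ∈ ballUnion x r ↔ ∃ i, dist y (x i) ≤ r := by
  simp only [ballUnion, mem_iUnion, Metric.mem_closedBall]

theorem exists_isCutoff_ballUnion (x : ι → E d) {r R : ℝ} {K : NNReal} (hK : 1 < K * (R - r)) :
    ∃ ζ, IsCutoff (ballUnion x r) (ballUnion x R) K ζ := by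
  refine exists_isCutoff (fun y hy z hz => ?_) hK
  obtain ⟨i, hi⟩ := mem_ballUnion.1 hy
  have hzi : R < dist z (x i) := not_le.1 fun h => hz (mem_ballUnion.2 ⟨i, h⟩)
  linarith [dist_triangle_left z (x i) y]

theorem volume_real_closedBall (x : E d) {r : ℝ} (hr : 0 ≤ r) :
    volume.real (Metric.closedBall x r) = unitBallVolume d * r ^ d := by
  rw [Measure.addHaar_real_closedBall _ _ hr, finrank_euclideanSpace_fin, mul_comm]
  rfl

theorem unitBallVolume_pos : 0 < unitBallVolume d :=
  ENNReal.toReal_pos (Metric.measure_ball_pos _ _ one_pos).ne' measure_ball_lt_top.ne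

theorem isCompact_ballUnion [Finite ι] (x : ι → E d) (r : ℝ) : IsCompact (ballUnion x r) :=
  isCompact_iUnion fun _ => isCompact_closedBall _ _

theorem measurableSet_ballUnion [Finite ι] (x : ι → E d) (r : ℝ) : MeasurableSet (ballUnion x r) :=
  (isCompact_ballUnion x r).measurableSet

variable [Fintype ι]

theorem volume_real_ballUnion_le (x : ι → E d) {r : ℝ} (hr : 0 ≤ r) :
    volume.real (ballUnion x r) ≤ Fintype.card ι * (unitBallVolume d * r ^ d) := by
  refine (measureReal_iUnion_fintype_le _).trans_eq ?_
  simp only [volume_real_closedBall _ hr, Finset.sum_const, Finset.card_univ, nsmul_eq_mul]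

theorem volume_real_ballUnion_diff_le (x : ι → E d) {r R : ℝ} (hr : 0 ≤ r) (hrR : r ≤ R) :
    volume.real (ballUnion x R \ ballUnion x r) ≤
      Fintype.card ι * (unitBallVolume d * (R ^ d - r ^ d)) := by
  have hshell : ∀ i, volume.real (Metric.closedBall (x i) R \ Metric.closedBall (x i) r) =
      unitBallVolume d * (R ^ d - r ^ d) := fun i => by
    rw [measureReal_sdiff (Metric.closedBall_subset_closedBall hrR) measurableSet_closedBall
      measure_closedBall_lt_top.ne, volume_real_closedBall _ hr,
      volume_real_closedBall _ (hr.trans hrR), mul_sub]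
  calc volume.real (ballUnion x R \ ballUnion x r)
      ≤ volume.real (⋃ i, Metric.closedBall (x i) R \ Metric.closedBall (x i) r) := by
        refine measureReal_mono (fun y hy => ?_) (measure_ne_top_of_subset
          (iUnion_mono fun i => sdiff_subset) (isCompact_ballUnion x R).measure_lt_top.ne)
        obtain ⟨i, hi⟩ := mem_iUnion.1 hy.1
        exact mem_iUnion.2 ⟨i, hi, fun hr => hy.2 (mem_iUnion.2 ⟨i, hr⟩)⟩
    _ ≤ ∑ i, volume.real (Metric.closedBall (x i) R \ Metric.closedBall (x i) r) :=
        measureReal_iUnion_fintype_le _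
    _ = Fintype.card ι * (unitBallVolume d * (R ^ d - r ^ d)) := by
        simp only [hshell, Finset.sum_const, Finset.card_univ, nsmul_eq_mul]

end BallUnion

/-! ### Grids in the unit cube -/

theorem isOpen_unitCube : IsOpen (unitCube d) := by
  simp only [unitCube, ofPred_forall]
  exact isOpen_iInter_of_finite fun i => isOpen_Ioo.preimage (by fun_prop)

theorem volume_unitCube : volume (unitCube d) = 1 := by
  have hpi : unitCube d = (MeasurableEquiv.toLp 2 (Fin d → ℝ)).symm ⁻¹'
      (univ.pi fun _ : Fin d => Ioo (0 : ℝ) 1) := by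
    ext x
    simp [unitCube]
  rw [hpi, (EuclideanSpace.volume_preserving_symm_measurableEquiv_toLp
    (Fin d)).measure_preimage_equiv, Real.volume_pi_Ioo]
  simp

theorem norm_le_mul_of_forall_abs_le {v : E d} {c : ℝ} (h : ∀ j, |v j| ≤ c) : ‖v‖ ≤ d * c := by
  calc ‖v‖ = ‖∑ j, v j • EuclideanSpace.basisFun (Fin d) ℝ j‖ := by
        conv_lhs => rw [← (EuclideanSpace.basisFun (Fin d) ℝ).sum_repr v]
        simp only [EuclideanSpace.basisFun_repr]
    _ ≤ ∑ _j : Fin d, c := norm_sum_le_of_le _ fun j _ => by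
        rw [norm_smul, OrthonormalBasis.norm_eq_one, mul_one]; exact h j
    _ = d * c := by simp

theorem isBounded_unitCube : Bornology.IsBounded (unitCube d) :=
  Metric.isBounded_iff_subset_closedBall 0 |>.2 ⟨d * 1, fun x hx => by
    rw [mem_closedBall_zero_iff]
    exact norm_le_mul_of_forall_abs_le fun j => abs_le.2 ⟨by linarith [(hx j).1], (hx j).2.le⟩⟩

theorem nonempty_unitCube : (unitCube d).Nonempty :=
  ⟨WithLp.toLp 2 fun _ => 1 / 2, fun _ => by norm_num⟩

theorem exists_abs_sub_midpoint_le {N : ℕ} (hN : 0 < N) {t : ℝ} (ht : t ∈ Ioo (0 : ℝ) 1) :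
    ∃ m : Fin N, |t - ((m : ℕ) + 1 / 2) / N| ≤ 1 / N := by
  have hN' : (0 : ℝ) < N := Nat.cast_pos.2 hN
  have htN : t * N < N := mul_lt_of_lt_one_left hN' ht.2
  refine ⟨⟨⌊t * N⌋₊, (Nat.floor_lt (mul_pos ht.1 hN').le).2 htN⟩, ?_⟩
  have hsub : t - ((⌊t * N⌋₊ : ℕ) + 1 / 2) / N = (t * N - ((⌊t * N⌋₊ : ℕ) + 1 / 2)) / N := by
    field_simp
  rw [hsub, abs_div, abs_of_pos hN']
  refine div_le_div_of_nonneg_right (abs_le.2 ⟨?_, ?_⟩) hN'.le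
  · linarith [Nat.floor_le (mul_pos ht.1 hN').le]
  · linarith [Nat.lt_floor_add_one (t * N)]

theorem exists_grid {n : ℕ} (N : Fin d → ℕ) (hN : ∀ j, 0 < N j) (hn : ∏ j, N j ≤ n) :
    ∃ x : Fin n → E d, (∀ i, x i ∈ unitCube d) ∧
      ∀ y ∈ unitCube d, ∃ i, ∀ j, |y j - x i j| ≤ 1 / N j := by
  have hne : ∀ j, Nonempty (Fin (N j)) := fun j => ⟨⟨0, hN j⟩⟩
  have hN' : ∀ j, (0 : ℝ) < N j := fun j => Nat.cast_pos.2 (hN j)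
  obtain ⟨s, hs⟩ : ∃ s : Fin n → ∀ j, Fin (N j), Function.Surjective s := by
    obtain ⟨e⟩ : Nonempty ((∀ j, Fin (N j)) ↪ Fin n) := by
      rw [Function.Embedding.nonempty_iff_card_le]
      simpa using hn
    exact ⟨_, Function.invFun_surjective e.injective⟩
  refine ⟨fun i => WithLp.toLp 2 fun j => ((s i j : ℕ) + 1 / 2 : ℝ) / N j,
    fun i j => ⟨div_pos (by positivity) (hN' j), ?_⟩, fun y hy => ?_⟩
  · have hlt : ((s i j : ℕ) : ℝ) + 1 ≤ N j := by exact_mod_cast (s i j).2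
    rw [div_lt_one (hN' j)]
    linarith
  · choose m hm using fun j => exists_abs_sub_midpoint_le (hN j) (hy j)
    obtain ⟨i, rfl⟩ := hs m
    exact ⟨i, hm⟩

theorem exists_anisotropic_grid {k n p : ℕ} (hp : 0 < p) {a : ℝ} (han : a ^ (k + 1) = n)
    (hpa : (p : ℝ) ^ k ≤ a) :
    ∃ x : Fin n → E (k + 1), (∀ i, x i ∈ unitCube (k + 1)) ∧ ∀ y ∈ unitCube (k + 1), ∃ i,
      |y 0 - x i 0| ≤ 2 * p ^ k / a ∧ ∀ j : Fin k, |y j.succ - x i j.succ| ≤ 2 / (p * a) := by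
  have hp' : (0 : ℝ) < p := Nat.cast_pos.2 hp
  have hpk : (0 : ℝ) < p ^ k := pow_pos hp' k
  have ha : 0 < a := hpk.trans_le hpa
  set m := ⌊a / p ^ k⌋₊
  have hm1 : 1 ≤ m := (Nat.one_le_floor_iff _).2 ((one_le_div hpk).2 hpa)
  have hma : (p : ℝ) ^ k * m ≤ a := by
    rw [mul_comm, ← le_div_iff₀ hpk]
    exact Nat.floor_le (div_pos ha hpk).le
  have ham : a ≤ 2 * p ^ k * m := by
    have hm1' : (1 : ℝ) ≤ m := Nat.one_le_cast.2 hm1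
    have hlt : a < (m + 1) * p ^ k := (div_lt_iff₀ hpk).1 (Nat.lt_floor_add_one _)
    nlinarith
  obtain ⟨x, hx, hgrid⟩ := exists_grid (n := n) (Fin.cons m fun _ : Fin k => p ^ (k + 1) * m)
    (Fin.cases hm1 fun _ => Nat.mul_pos (pow_pos hp _) hm1) (by
      have hle : ((p ^ k * m) ^ (k + 1) : ℝ) ≤ n := han ▸ pow_le_pow_left₀ (by positivity) hma _
      rw [Fin.prod_univ_succ]
      simp only [Fin.cons_zero, Fin.cons_succ, Finset.prod_const, Finset.card_fin]
      calc m * (p ^ (k + 1) * m) ^ k = (p ^ k * m) ^ (k + 1) := by ring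
        _ ≤ n := by exact_mod_cast hle)
  refine ⟨x, hx, fun y hy => ?_⟩
  obtain ⟨i, hi⟩ := hgrid y hy
  refine ⟨i, (hi 0).trans ?_, fun j => (hi j.succ).trans ?_⟩
  · rw [Fin.cons_zero, div_le_div_iff₀ (by positivity) ha]
    linarith
  · rw [Fin.cons_succ, div_le_div_iff₀ (by positivity) (by positivity)]
    push_cast
    rw [pow_succ]
    nlinarith

/-! ### The scaled compliance -/

/-- The quantity `n^(2/d) F(Σ)` whose lower limits define `θ`, where `Σ` is the union of the `n`
closed balls of radius `α n^(-1/d)` centred at the points `x i`. -/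
noncomputable def scaledCompliance {n : ℕ} (x : Fin n → E d) (α : ℝ) : ℝ :=
  (n : ℝ) ^ (2 / (d : ℝ)) *
    compliance (ballUnion x (α * (n : ℝ) ^ (-(1 / (d : ℝ))))) (fun _ => 1) (unitCube d)

theorem rpow_mul_compliance_closure_inter {n : ℕ} (x : Fin n → E d) (α : ℝ) :
    (n : ℝ) ^ (2 / (d : ℝ)) * compliance
      (closure (unitCube d) ∩ ballUnion x (α * (n : ℝ) ^ (-(1 / (d : ℝ))))) (fun _ => 1)
      (unitCube d) = scaledCompliance x α := by
  rw [scaledCompliance]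
  congr 1
  refine compliance_congr ?_ _
  rw [sdiff_inter, sdiff_eq_empty.2 subset_closure, empty_union]

theorem scaledCompliance_eq {n : ℕ} (x : Fin n → E d) (α : ℝ) {a : ℝ}
    (ha : a = (n : ℝ) ^ (1 / (d : ℝ))) :
    scaledCompliance x α = a ^ 2 * compliance (ballUnion x (α / a)) (fun _ => 1) (unitCube d) := by
  rw [scaledCompliance, ha, ← Real.rpow_mul_natCast n.cast_nonneg, Real.rpow_neg n.cast_nonneg,
    div_eq_mul_inv α]
  congr 2
  push_cast
  ring

theorem volume_real_ballUnion_div_le {n : ℕ} (x : Fin n → E d) {a β : ℝ} (ha : 0 < a)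
    (han : a ^ d = n) (hβ : 0 ≤ β) :
    volume.real (ballUnion x (β / a)) ≤ unitBallVolume d * β ^ d := by
  refine (volume_real_ballUnion_le x (by positivity)).trans_eq ?_
  rw [Fintype.card_fin, ← han, div_pow]
  field_simp

theorem volume_real_ballUnion_div_diff_le {n : ℕ} (x : Fin n → E d) {a α β : ℝ} (ha : 0 < a)
    (han : a ^ d = n) (hα : 0 ≤ α) (hαβ : α ≤ β) :
    volume.real (ballUnion x (β / a) \ ballUnion x (α / a)) ≤
      unitBallVolume d * (β ^ d - α ^ d) := by
  refine (volume_real_ballUnion_diff_le x (by positivity) (by gcongr)).trans_eq ?_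
  rw [Fintype.card_fin, ← han, div_pow, div_pow]
  field_simp

theorem memLp_indicator_unitCube : MemLp ((unitCube d).indicator fun _ => (1 : ℝ)) 2 volume :=
  memLp_indicator_one isBounded_unitCube isOpen_unitCube.measurableSet

section NeZero

variable [NeZero d]

theorem scaledCompliance_nonneg {n : ℕ} (x : Fin n → E d) (α : ℝ) : 0 ≤ scaledCompliance x α :=
  mul_nonneg (Real.rpow_nonneg n.cast_nonneg _) (compliance_nonneg isBounded_unitCube
    isOpen_unitCube.measurableSet memLp_indicator_unitCube)

theorem rpow_one_div_pow (n : ℕ) : ((n : ℝ) ^ (1 / (d : ℝ))) ^ d = n := by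
  rw [one_div]
  exact Real.rpow_inv_natCast_pow n.cast_nonneg (NeZero.ne d)

theorem tendsto_rpow_one_div :
    Tendsto (fun n : ℕ => (n : ℝ) ^ (1 / (d : ℝ))) atTop atTop :=
  (tendsto_rpow_atTop (one_div_pos.2 (Nat.cast_pos.2 (NeZero.pos d)))).comp
    tendsto_natCast_atTop_atTop

theorem add_le_scaledCompliance {n : ℕ} (hn : 0 < n) (x : Fin n → E d) {α β h η : ℝ} {k : NNReal}
    (hα : 0 < α) (hαβ : α < β) (hk : 1 < k * (β - α)) {χ : E d → ℝ}
    (hχ : IsTestFunction (unitCube d) χ) (hχh : ∀ y, χ y ∈ Icc 0 h) (hη : 0 < η) :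
    (1 + η)⁻¹ * scaledCompliance x β + 2 * ((∫ y, χ y) - h * (unitBallVolume d * β ^ d))
        - (1 + η) * ((h * k) ^ 2 * (unitBallVolume d * (β ^ d - α ^ d)))
        - (1 + η⁻¹) * (∫ y, ‖gradient χ y‖ ^ 2) / ((n : ℝ) ^ (1 / (d : ℝ))) ^ 2
      ≤ scaledCompliance x α := by
  set a : NNReal := (n : NNReal) ^ (1 / (d : ℝ)) with ha_def
  have ha : (a : ℝ) = (n : ℝ) ^ (1 / (d : ℝ)) := by rw [ha_def, NNReal.coe_rpow, NNReal.coe_natCast]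
  have ha0 : (0 : ℝ) < a := ha ▸ Real.rpow_pos_of_pos (Nat.cast_pos.2 hn) _
  have han : (a : ℝ) ^ d = n := by rw [ha, rpow_one_div_pow]
  have hh : 0 ≤ h := (hχh 0).1.trans (hχh 0).2
  have hball := volume_real_ballUnion_div_le x ha0 han (hα.trans hαβ).le
  have hshell := volume_real_ballUnion_div_diff_le x ha0 han hα.le hαβ.le
  obtain ⟨ζ, hζ⟩ := exists_isCutoff_ballUnion x (r := α / a) (R := β / a) (K := k * a) (by
    rw [NNReal.coe_mul, ← sub_div, mul_assoc, mul_div_cancel₀ _ ha0.ne']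
    exact hk)
  have hcutoff := hζ.add_le_compliance (measurableSet_ballUnion _ _) (measurableSet_ballUnion _ _)
    (isCompact_ballUnion _ _).measure_lt_top.ne isBounded_unitCube isOpen_unitCube.measurableSet
    (hχ.const_mul ((a : ℝ) ^ 2)⁻¹) (h := ((a : ℝ) ^ 2)⁻¹ * h)
    (fun y => ⟨mul_nonneg (by positivity) (hχh y).1,
      mul_le_mul_of_nonneg_left (hχh y).2 (by positivity)⟩) hη
  simp only [gradient_fun_const_mul (hχ.differentiable _), norm_smul, mul_pow, integral_const_mul,
    norm_inv, norm_pow, NNReal.norm_eq, NNReal.coe_mul] at hcutoff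
  rw [← ha, scaledCompliance_eq x α ha, scaledCompliance_eq x β ha]
  refine le_trans ?_ (mul_le_mul_of_nonneg_left hcutoff (sq_nonneg (a : ℝ)))
  calc _ ≤ (1 + η)⁻¹ * ((a : ℝ) ^ 2 * compliance (ballUnion x (β / a)) (fun _ => 1) (unitCube d))
          + 2 * ((∫ y, χ y) - h * volume.real (ballUnion x (β / a)))
          - (1 + η) * ((h * k) ^ 2 * volume.real (ballUnion x (β / a) \ ballUnion x (α / a)))
          - (1 + η⁻¹) * (∫ y, ‖gradient χ y‖ ^ 2) / (a : ℝ) ^ 2 := by gcongr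
    _ = _ := by field_simp

end NeZero

/-! ### Upper bounds from grids -/

theorem PoincareOn.scaledCompliance_le {n : ℕ} {x : Fin n → E d} {α a C : ℝ}
    (hP : PoincareOn (unitCube d \ ballUnion x (α / a)) C) (hC : 0 ≤ C)
    (ha : a = (n : ℝ) ^ (1 / (d : ℝ))) : scaledCompliance x α ≤ a ^ 2 * C := by
  have hle := hP.compliance_le hC isOpen_unitCube.measurableSet memLp_indicator_unitCube
  have hvol : ∫ y in unitCube d, (1 : ℝ) ^ 2 = 1 := by
    simp [measureReal_def, volume_unitCube]
  rw [hvol, mul_one] at hle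
  rw [scaledCompliance_eq x α ha]
  exact mul_le_mul_of_nonneg_left hle (sq_nonneg a)

theorem exists_scaledCompliance_le {k n p : ℕ} (hp : 0 < p) {α : ℝ} (hαp : 2 * (k + 1) ≤ p * α)
    (hpn : (p : ℝ) ^ k ≤ (n : ℝ) ^ (1 / ((k + 1 : ℕ) : ℝ))) :
    ∃ x : Fin n → E (k + 1), (∀ i, x i ∈ unitCube (k + 1)) ∧
      scaledCompliance x α ≤ 2 * (2 * p ^ k) ^ 2 := by
  set a := (n : ℝ) ^ (1 / ((k + 1 : ℕ) : ℝ)) with ha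
  have hp' : (0 : ℝ) < p := Nat.cast_pos.2 hp
  have ha0 : 0 < a := (pow_pos hp' k).trans_le hpn
  obtain ⟨x, hx, hgrid⟩ := exists_anisotropic_grid (a := a) hp (rpow_one_div_pow n) hpn
  refine ⟨x, hx, ?_⟩
  have hP : PoincareOn (unitCube (k + 1) \ ballUnion x (α / a)) (2 * (2 * p ^ k / a) ^ 2) := by
    refine poincareOn_of_forall_exists_notMem (e := EuclideanSpace.single 0 1) (by simp)
      (by positivity) fun y hy => ?_
    obtain ⟨i, hi0, hi⟩ := hgrid y hy.1
    refine ⟨x i 0 - y 0, abs_sub_comm (y 0) (x i 0) ▸ hi0,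
      fun hmem => hmem.2 (mem_ballUnion.2 ⟨i, ?_⟩)⟩
    have hoffset : ∀ j, |(y + (x i 0 - y 0) • EuclideanSpace.single 0 1 - x i : E (k + 1)) j| ≤
        2 / (p * a) := by
      refine Fin.cases ?_ fun j => ?_
      · have : 0 ≤ 2 / (p * a) := by positivity
        simpa using this
      · simpa using hi j
    rw [dist_eq_norm]
    refine (norm_le_mul_of_forall_abs_le hoffset).trans ?_
    rw [mul_div_assoc', div_le_div_iff₀ (by positivity) ha0]
    push_cast
    nlinarith
  exact (hP.scaledCompliance_le (by positivity) ha).trans_eq (by field_simp)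

theorem exists_scaledCompliance_two_mul_nonpos {k n : ℕ} (hn : 0 < n) :
    ∃ x : Fin n → E (k + 1), (∀ i, x i ∈ unitCube (k + 1)) ∧
      scaledCompliance x (2 * (k + 1 : ℕ)) ≤ 0 := by
  set a := (n : ℝ) ^ (1 / ((k + 1 : ℕ) : ℝ)) with ha
  have ha1 : 1 ≤ a := Real.one_le_rpow (Nat.one_le_cast.2 hn) (by positivity)
  obtain ⟨x, hx, hgrid⟩ := exists_anisotropic_grid (p := 1) (a := a) one_pos (rpow_one_div_pow n)
    (by rwa [Nat.cast_one, one_pow])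
  refine ⟨x, hx, ?_⟩
  have hcover : unitCube (k + 1) ⊆ ballUnion x (2 * (k + 1 : ℕ) / a) := fun y hy => by
    obtain ⟨i, hi0, hi⟩ := hgrid y hy
    have hoffset : ∀ j, |(y - x i) j| ≤ 2 / a :=
      Fin.cases (by simpa using hi0) fun j => by simpa using hi j
    refine mem_ballUnion.2 ⟨i, (dist_eq_norm y (x i)).trans_le ?_⟩
    exact (norm_le_mul_of_forall_abs_le hoffset).trans_eq (by ring)
  have hP : PoincareOn (unitCube (k + 1) \ ballUnion x (2 * (k + 1 : ℕ) / a)) 0 := by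
    rw [sdiff_eq_empty.2 hcover]
    simpa using poincareOn_of_forall_exists_notMem (U := ∅) (e := EuclideanSpace.single 0 1)
      (by simp) le_rfl (by simp)
  exact (hP.scaledCompliance_le le_rfl ha).trans_eq (mul_zero _)

/-! ### The function `θ` -/

/-- A sequence of `n`-tuples of centres admissible at level `α`: the `n`-th tuple lies in the
`α n^(-1/d)`-neighbourhood of the unit cube. -/
def IsAdmissibleCentres (α : ℝ) (x : ∀ n : ℕ, Fin n → E d) : Prop :=
  ∀ (n : ℕ) i, x n i ∈ Metric.thickening (α * (n : ℝ) ^ (-(1 / (d : ℝ)))) (unitCube d)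

theorem IsAdmissibleCentres.mono {α β : ℝ} {x : ∀ n : ℕ, Fin n → E d}
    (hx : IsAdmissibleCentres α x) (hαβ : α ≤ β) : IsAdmissibleCentres β x := fun n i =>
  Metric.thickening_mono (mul_le_mul_of_nonneg_right hαβ (Real.rpow_nonneg n.cast_nonneg _)) _
    (hx n i)

theorem isAdmissibleCentres_of_mem {α : ℝ} (hα : 0 < α) {x : ∀ n : ℕ, Fin n → E d}
    (hx : ∀ n i, x n i ∈ unitCube d) : IsAdmissibleCentres α x := fun n i =>
  Metric.self_subset_thickening (mul_pos hα (Real.rpow_pos_of_pos (Nat.cast_pos.2 i.pos) _)) _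
    (hx n i)

theorem thetaExt_eq_iInf (α : ℝ) : thetaExt d α =
    ⨅ (x : ∀ n : ℕ, Fin n → E d) (_ : IsAdmissibleCentres α x),
      liminf (fun n => ENNReal.ofReal (scaledCompliance (x n) α)) atTop := by
  apply le_antisymm
  · refine le_iInf₂ fun x hx => ?_
    simp only [← rpow_mul_compliance_closure_inter]
    exact iInf₂_le _ fun n => ⟨x n, hx n, rfl⟩
  · refine le_iInf₂ fun S hS => ?_
    choose x hx hS using hS
    refine (iInf₂_le x hx).trans_eq ?_
    simp only [← rpow_mul_compliance_closure_inter, hS]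
    rfl

theorem thetaExt_le {α c : ℝ} (hα : 0 < α)
    (h : ∀ᶠ n : ℕ in atTop, ∃ x : Fin n → E d, (∀ i, x i ∈ unitCube d) ∧ scaledCompliance x α ≤ c) :
    thetaExt d α ≤ ENNReal.ofReal c := by
  obtain ⟨p, hp⟩ := nonempty_unitCube (d := d)
  have hexists : ∀ n : ℕ, ∃ x : Fin n → E d, (∀ i, x i ∈ unitCube d) ∧
      ((∃ y : Fin n → E d, (∀ i, y i ∈ unitCube d) ∧ scaledCompliance y α ≤ c) →
        scaledCompliance x α ≤ c) := fun n => by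
    by_cases hn : ∃ y : Fin n → E d, (∀ i, y i ∈ unitCube d) ∧ scaledCompliance y α ≤ c
    · exact hn.imp fun y hy => ⟨hy.1, fun _ => hy.2⟩
    · exact ⟨fun _ => p, fun _ => hp, fun h => absurd h hn⟩
  choose x hx hxc using hexists
  rw [thetaExt_eq_iInf]
  refine (iInf₂_le x (isAdmissibleCentres_of_mem hα hx)).trans ?_
  refine (liminf_le_liminf ?_).trans (liminf_const _).le
  exact h.mono fun n hn => ENNReal.ofReal_le_ofReal (hxc n hn)

theorem theta_nonneg (α : ℝ) : 0 ≤ theta d α := ENNReal.toReal_nonneg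

section NeZero

variable [NeZero d]

theorem thetaExt_lt_top {α : ℝ} (hα : 0 < α) : thetaExt d α < ⊤ := by
  obtain ⟨k, rfl⟩ := Nat.exists_eq_succ_of_ne_zero (NeZero.ne d)
  obtain ⟨p, hp⟩ := exists_nat_gt (2 * (k + 1) / α)
  have hp0 : 0 < p := Nat.cast_pos.1 (lt_trans (by positivity) hp)
  refine (thetaExt_le (c := 2 * (2 * p ^ k) ^ 2) hα ?_).trans_lt ENNReal.ofReal_lt_top
  filter_upwards [(tendsto_rpow_one_div (d := k + 1)).eventually_ge_atTop ((p : ℝ) ^ k)] with n hn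
  exact exists_scaledCompliance_le hp0 ((div_le_iff₀ hα).1 hp.le) hn

theorem thetaExt_two_mul_eq_zero : thetaExt d (2 * d) = 0 := by
  obtain ⟨k, rfl⟩ := Nat.exists_eq_succ_of_ne_zero (NeZero.ne d)
  refine le_antisymm ((thetaExt_le (c := 0) (by positivity) ?_).trans_eq ENNReal.ofReal_zero)
    zero_le
  filter_upwards [eventually_gt_atTop 0] with n hn
  exact exists_scaledCompliance_two_mul_nonpos hn

theorem ofReal_theta {α : ℝ} (hα : 0 < α) : ENNReal.ofReal (theta d α) = thetaExt d α :=
  ENNReal.ofReal_toReal (thetaExt_lt_top hα).ne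

theorem le_theta {α c : ℝ} (hα : 0 < α) (h : ∀ x : ∀ n : ℕ, Fin n → E d,
    IsAdmissibleCentres α x → ∀ᶠ n in atTop, c ≤ scaledCompliance (x n) α) : c ≤ theta d α := by
  rw [← ENNReal.ofReal_le_ofReal_iff (theta_nonneg α), ofReal_theta hα, thetaExt_eq_iInf]
  exact le_iInf₂ fun x hx => le_liminf_of_le (by isBoundedDefault)
    ((h x hx).mono fun n hn => ENNReal.ofReal_le_ofReal hn)

theorem eventually_theta_sub_le {α ε : ℝ} (hα : 0 < α) (hε : 0 < ε) {x : ∀ n : ℕ, Fin n → E d}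
    (hx : IsAdmissibleCentres α x) :
    ∀ᶠ n in atTop, theta d α - ε ≤ scaledCompliance (x n) α := by
  rcases lt_or_ge (theta d α - ε) 0 with h | h
  · exact Eventually.of_forall fun n => h.le.trans (scaledCompliance_nonneg _ _)
  have hlt : ENNReal.ofReal (theta d α - ε) <
      liminf (fun n => ENNReal.ofReal (scaledCompliance (x n) α)) atTop := by
    calc ENNReal.ofReal (theta d α - ε) < ENNReal.ofReal (theta d α) :=
          (ENNReal.ofReal_lt_ofReal_iff (by linarith)).2 (by linarith)
      _ = thetaExt d α := ofReal_theta hα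
      _ ≤ _ := (thetaExt_eq_iInf α).trans_le (iInf₂_le x hx)
  filter_upwards [eventually_lt_of_lt_liminf hlt] with n hn
  exact (ENNReal.ofReal_lt_ofReal_iff_of_nonneg h).1 hn |>.le

theorem theta_add_le_of_pos {α β q ε : ℝ} (hα : 0 < α) (hαβ : α < β) (hq : 0 ≤ q) (hε : 0 < ε) :
    (1 + ε)⁻¹ * (theta d β - ε)
        + 2 * (q * (β - α)) * (1 - ε - unitBallVolume d * β ^ d)
        - (1 + ε) ^ 3 * (q ^ 2 * (unitBallVolume d * (β ^ d - α ^ d))) - ε ≤ theta d α := by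
  have hβα : 0 < β - α := sub_pos.2 hαβ
  have hk : 0 ≤ (1 + ε) / (β - α) := by positivity
  lift (1 + ε) / (β - α) to NNReal using hk with k hkk
  obtain ⟨χ, hχ, hχ1, hχi⟩ := exists_isTestFunction_le_integral (c := 1 - ε)
    (isOpen_unitCube (d := d)) isBounded_unitCube (by
      rw [measureReal_def, volume_unitCube, ENNReal.toReal_one]; linarith)
  have hprofile := hχ.const_mul (q * (β - α))
  set G := ∫ y, ‖gradient (fun y => q * (β - α) * χ y) y‖ ^ 2
  have herr : Tendsto (fun n : ℕ => (1 + ε⁻¹) * G / ((n : ℝ) ^ (1 / (d : ℝ))) ^ 2) atTop (𝓝 0) :=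
    tendsto_const_nhds.div_atTop ((tendsto_pow_atTop two_ne_zero).comp tendsto_rpow_one_div)
  refine le_theta hα fun x hx => ?_
  filter_upwards [eventually_theta_sub_le (hα.trans hαβ) hε (hx.mono hαβ.le),
    herr.eventually_le_const hε, eventually_gt_atTop 0] with n hθ hG hn
  have hstep := add_le_scaledCompliance hn (x n) hα hαβ (h := q * (β - α)) (k := k) (by
    rw [hkk, div_mul_cancel₀ _ hβα.ne']; linarith) hprofile
    (fun y => ⟨mul_nonneg (by positivity) (hχ1 y).1, mul_le_of_le_one_right (by positivity)
      (hχ1 y).2⟩) hε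
  rw [integral_const_mul, hkk, ← mul_sub, ← mul_assoc 2] at hstep
  have hhk : q * (β - α) * ((1 + ε) / (β - α)) = q * (1 + ε) := by field_simp
  rw [hhk] at hstep
  refine le_trans ?_ hstep
  have hθ' : (1 + ε)⁻¹ * (theta d β - ε) ≤ (1 + ε)⁻¹ * scaledCompliance (x n) β := by gcongr
  have hχi' := mul_le_mul_of_nonneg_left hχi (by positivity : 0 ≤ 2 * (q * (β - α)))
  linarith

theorem theta_add_le {α β q : ℝ} (hα : 0 < α) (hαβ : α < β) (hq : 0 ≤ q) :
    theta d β + 2 * (q * (β - α)) * (1 - unitBallVolume d * β ^ d)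
      - q ^ 2 * (unitBallVolume d * (β ^ d - α ^ d)) ≤ theta d α := by
  have hcont : ContinuousAt (fun ε : ℝ => (1 + ε)⁻¹ * (theta d β - ε)
      + 2 * (q * (β - α)) * (1 - ε - unitBallVolume d * β ^ d)
      - (1 + ε) ^ 3 * (q ^ 2 * (unitBallVolume d * (β ^ d - α ^ d))) - ε) 0 := by
    have : ContinuousAt (fun ε : ℝ => (1 + ε)⁻¹) 0 :=
      ContinuousAt.inv₀ (by fun_prop) (by norm_num)
    fun_prop
  have hle := le_of_tendsto (hcont.tendsto.mono_left (nhdsWithin_le_nhds (s := Ioi 0)))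
    (eventually_mem_nhdsWithin.mono fun ε hε => theta_add_le_of_pos hα hαβ hq hε)
  simpa using hle

theorem antitoneOn_theta : AntitoneOn (theta d) (Ioi 0) := by
  intro α hα β _ hαβ
  rcases hαβ.eq_or_lt with rfl | h
  · exact le_rfl
  · simpa using theta_add_le hα h le_rfl

theorem ae_differentiableAt_theta :
    ∀ᵐ α : ℝ, 0 < α → DifferentiableAt ℝ (theta d) α := by
  filter_upwards [(antitoneOn_theta (d := d)).neg.ae_differentiableWithinAt_of_mem] with α hα hα0
  simpa using ((hα hα0).differentiableAt (isOpen_Ioi.mem_nhds hα0)).neg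

end NeZero

/-! ### Lower bounds for `θ` and its derivative -/

section NeZero

variable [NeZero d]

theorem theta_pos_of_lt {α β : ℝ} (hα : 0 < α) (hαβ : α < β)
    (hβ : unitBallVolume d * β ^ d < 1) : 0 < theta d α := by
  set A := (β - α) * (1 - unitBallVolume d * β ^ d) with hA
  set B := unitBallVolume d * (β ^ d - α ^ d)
  have hA0 : 0 < A := mul_pos (sub_pos.2 hαβ) (sub_pos.2 hβ)
  have hB0 : 0 < B := mul_pos unitBallVolume_pos
    (sub_pos.2 (pow_lt_pow_left₀ hαβ hα.le (NeZero.ne d)))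
  -- `q = A / B` maximizes `2 q A - q² B`.
  have hle := theta_add_le (d := d) hα hαβ (q := A / B) (div_pos hA0 hB0).le
  calc 0 < A ^ 2 / B := div_pos (pow_pos hA0 2) hB0
    _ ≤ theta d β + A ^ 2 / B := le_add_of_nonneg_left (theta_nonneg β)
    _ = theta d β + 2 * (A / B * (β - α)) * (1 - unitBallVolume d * β ^ d) - (A / B) ^ 2 * B := by
      have hAB : 2 * (A / B * (β - α)) * (1 - unitBallVolume d * β ^ d) = 2 * (A / B) * A := by
        rw [hA]; ring
      rw [hAB]
      field_simp
      ring
    _ ≤ theta d α := hle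

theorem t₁_pos : 0 < t₁ d := by
  have hsmall : ∀ᶠ β : ℝ in 𝓝[>] 0, unitBallVolume d * β ^ d < 1 := by
    have hcont : Continuous fun β : ℝ => unitBallVolume d * β ^ d := by fun_prop
    refine nhdsWithin_le_nhds (hcont.tendsto 0 |>.eventually_lt_const ?_)
    rw [zero_pow (NeZero.ne d), mul_zero]
    exact one_pos
  obtain ⟨β, hβ, hβ0⟩ := (hsmall.and self_mem_nhdsWithin).exists
  refine hβ0.trans_le (le_csInf ⟨2 * d, ?_, thetaExt_two_mul_eq_zero⟩ fun t ⟨ht, h0⟩ => ?_)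
  · exact mul_pos two_pos (Nat.cast_pos.2 (NeZero.pos d))
  · by_contra! hlt
    have hpos := theta_pos_of_lt ht hlt hβ
    rw [theta, h0, ENNReal.toReal_zero] at hpos
    exact hpos.false

theorem le_neg_deriv_theta_of_nonneg {α q : ℝ} (hα : 0 < α) (hq : 0 ≤ q)
    (hdiff : DifferentiableAt ℝ (theta d) α) :
    2 * q * (1 - unitBallVolume d * α ^ d) - q ^ 2 * (unitBallVolume d * (d * α ^ (d - 1)))
      ≤ -deriv (theta d) α := by
  let G : ℝ → ℝ := fun β => theta d β + 2 * (q * (β - α)) * (1 - unitBallVolume d * β ^ d) -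
    q ^ 2 * (unitBallVolume d * (β ^ d - α ^ d))
  have hpow := hasDerivAt_pow d α
  have hprod : HasDerivAt (fun β : ℝ => 2 * (q * (β - α)) * (1 - unitBallVolume d * β ^ d))
      (2 * q * (1 - unitBallVolume d * α ^ d)) α := by
    refine (((((hasDerivAt_id α).sub_const α).const_mul q).const_mul 2).mul
      ((hpow.const_mul _).const_sub 1)).congr_deriv ?_
    simp
  have hG := (hdiff.hasDerivAt.add hprod).sub
    (((hpow.sub_const (α ^ d)).const_mul (unitBallVolume d)).const_mul (q ^ 2))
  have hslope : ∀ᶠ β in 𝓝[>] α, slope G α β ≤ 0 := by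
    filter_upwards [self_mem_nhdsWithin] with β hβ
    have hGα : G α = theta d α := by simp [G]
    rw [slope_def_field, hGα]
    exact div_nonpos_of_nonpos_of_nonneg (sub_nonpos.2 (theta_add_le hα hβ hq))
      (sub_nonneg.2 (mem_Ioi.1 hβ).le)
  have hle := le_of_tendsto
    ((hasDerivAt_iff_tendsto_slope.1 hG).mono_left (nhdsGT_le_nhdsNE α)) hslope
  linarith

theorem le_neg_deriv_theta {α : ℝ} (hα : 0 < α) (hdiff : DifferentiableAt ℝ (theta d) α) :
    α ^ (1 - (d : ℝ)) / (d * unitBallVolume d) - 2 * (α / d) ≤ -deriv (theta d) α := by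
  have hω : 0 < unitBallVolume d := unitBallVolume_pos
  have hd : (0 : ℝ) < d := Nat.cast_pos.2 (NeZero.pos d)
  have hpow : α ^ (1 - (d : ℝ)) = (α ^ (d - 1))⁻¹ := by
    rw [← Real.rpow_natCast, ← Real.rpow_neg hα.le, Nat.cast_sub NeZero.one_le, Nat.cast_one,
      neg_sub]
  have hsucc : α ^ d = α ^ (d - 1) * α := by rw [← pow_succ, Nat.sub_add_cancel NeZero.one_le]
  -- The bound is optimized, up to the volume term, by `q = 1 / (d ω_d α^(d-1))`.
  refine le_trans (le_of_eq ?_) (le_neg_deriv_theta_of_nonneg hα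
    (q := α ^ (1 - (d : ℝ)) / (d * unitBallVolume d)) (by positivity) hdiff)
  rw [hpow, hsucc]
  field_simp
  ring

theorem sub_le_theta {Ψ : ℝ → ℝ} {α β : ℝ} (hα : 0 < α) (hαβ : α ≤ β)
    (hΨ : ∀ s, 0 < s →
      HasDerivAt Ψ (-(s ^ (1 - (d : ℝ)) / (d * unitBallVolume d) - 2 * (s / d))) s) :
    Ψ α - Ψ β ≤ theta d α := by
  set ψ : ℝ → ℝ := fun s => s ^ (1 - (d : ℝ)) / (d * unitBallVolume d) - 2 * (s / d)
  have hpos : ∀ s ∈ uIcc α β, 0 < s := fun s hs => hα.trans_le (uIcc_of_le hαβ ▸ hs).1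
  have hψi : IntervalIntegrable ψ volume α β := ContinuousOn.intervalIntegrable <|
    ContinuousOn.sub (ContinuousOn.div_const (fun s hs => (Real.continuousAt_rpow_const s _
      (Or.inl (hpos s hs).ne')).continuousWithinAt) _) (by fun_prop)
  have hmono : MonotoneOn (fun s => -theta d s) (uIcc α β) := antitoneOn_theta.neg.mono hpos
  have hψ_le : ∀ᵐ s ∂volume.restrict (Icc α β), ψ s ≤ deriv (fun s => -theta d s) s := by
    rw [ae_restrict_iff' measurableSet_Icc]
    filter_upwards [ae_differentiableAt_theta (d := d)] with s hs hsI
    rw [deriv.fun_neg]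
    exact le_neg_deriv_theta (hα.trans_le hsI.1) (hs (hα.trans_le hsI.1))
  have hint_le : ∫ s in α..β, deriv (fun s => -theta d s) s ≤ theta d α - theta d β := by
    have hle : -theta d α ≤ -theta d β := hmono left_mem_uIcc right_mem_uIcc hαβ
    have hmem := hmono.intervalIntegral_deriv_mem_uIcc
    rw [uIcc_of_le (sub_nonneg.2 hle)] at hmem
    linarith [hmem.2]
  calc Ψ α - Ψ β = ∫ s in α..β, ψ s := by
        rw [intervalIntegral.integral_eq_sub_of_hasDerivAt (f := fun s => -Ψ s)
          (fun s hs => (hΨ s (hpos s hs)).neg.congr_deriv (neg_neg _)) hψi]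
        ring
    _ ≤ ∫ s in α..β, deriv (fun s => -theta d s) s :=
        intervalIntegral.integral_mono_ae_restrict hαβ hψi hmono.intervalIntegrable_deriv hψ_le
    _ ≤ theta d α - theta d β := hint_le
    _ ≤ theta d α := sub_le_self _ (theta_nonneg β)

end NeZero

theorem rpow_div_sub_le_theta (hd : 3 ≤ d) {α : ℝ} (hα : 0 < α) :
    α ^ (2 - (d : ℝ)) / (d * ((d : ℝ) - 2) * unitBallVolume d) -
      (1 / (d * ((d : ℝ) - 2) * unitBallVolume d) + 1 / d) ≤ theta d α := by
  have : NeZero d := ⟨by omega⟩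
  have hd3 : (3 : ℝ) ≤ d := Nat.ofNat_le_cast.2 hd
  have hc : 0 < d * ((d : ℝ) - 2) * unitBallVolume d :=
    mul_pos (mul_pos (by linarith) (by linarith)) unitBallVolume_pos
  rcases le_total α 1 with h | h
  · have hint := sub_le_theta (d := d) hα h (Ψ := fun s =>
      s ^ (2 - (d : ℝ)) / (d * ((d : ℝ) - 2) * unitBallVolume d) + s ^ 2 / d) fun s hs => by
      refine (((Real.hasDerivAt_rpow_const (Or.inl hs.ne')).div_const _).add
        ((hasDerivAt_pow 2 s).div_const (d : ℝ))).congr_deriv ?_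
      have hd2 : (d : ℝ) - 2 ≠ 0 := by linarith
      rw [(by ring : 2 - (d : ℝ) - 1 = 1 - d)]
      field_simp
      ring
    rw [Real.one_rpow, one_pow] at hint
    linarith [(by positivity : 0 ≤ α ^ 2 / (d : ℝ))]
  · have hpow : α ^ (2 - (d : ℝ)) / (d * ((d : ℝ) - 2) * unitBallVolume d) ≤
        1 / (d * ((d : ℝ) - 2) * unitBallVolume d) :=
      div_le_div_of_nonneg_right (Real.rpow_le_one_of_one_le_of_nonpos h (by linarith)) hc.le
    linarith [theta_nonneg (d := d) α, (by positivity : 0 ≤ 1 / (d : ℝ))]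

theorem unitBallVolume_two : unitBallVolume 2 = Real.pi := by
  rw [unitBallVolume, measureReal_def, EuclideanSpace.volume_ball_fin_two]
  simp [Real.pi_nonneg]

theorem log_inv_div_sub_le_theta_two {α : ℝ} (hα : 0 < α) :
    Real.log α⁻¹ / (2 * Real.pi) - 1 / 2 ≤ theta 2 α := by
  rw [Real.log_inv, neg_div]
  rcases le_total α 1 with h | h
  · have hint := sub_le_theta (d := 2) hα h
      (Ψ := fun s => s ^ 2 / 2 - Real.log s / (2 * Real.pi)) fun s hs => by
      refine (((hasDerivAt_pow 2 s).div_const (2 : ℝ)).sub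
        ((Real.hasDerivAt_log hs.ne').div_const (2 * Real.pi))).congr_deriv ?_
      rw [unitBallVolume_two]
      norm_num [Real.rpow_neg_one]
      ring
    rw [Real.log_one, zero_div] at hint
    linarith [sq_nonneg α]
  · have hlog : 0 ≤ Real.log α / (2 * Real.pi) := div_nonneg (Real.log_nonneg h) Real.two_pi_pos.le
    linarith [theta_nonneg (d := 2) α]

end OptimalCompliance

theorem proposition4p5_general (d : ℕ) (hd : 1 ≤ d) :
    (∀ α : ℝ, 0 < α → OptimalCompliance.thetaExt d α < ⊤) ∧
    0 < OptimalCompliance.t₁ d ∧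
    (∀ᵐ α : ℝ, 0 < α → DifferentiableAt ℝ (OptimalCompliance.theta d) α) ∧
    (∀ α : ℝ, 0 < α → DifferentiableAt ℝ (OptimalCompliance.theta d) α →
      -deriv (OptimalCompliance.theta d) α ≥
        α ^ (1 - (d : ℝ)) / (d * OptimalCompliance.unitBallVolume d) - 2 * (α / d)) ∧
    (3 ≤ d → ∃ C : ℝ, ∀ α : ℝ, 0 < α →
      OptimalCompliance.theta d α ≥
        α ^ (2 - (d : ℝ)) / (d * ((d : ℝ) - 2) * OptimalCompliance.unitBallVolume d) - C) ∧
    (d = 2 → ∃ C : ℝ, ∀ α : ℝ, 0 < α →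
      OptimalCompliance.theta d α ≥ Real.log (α⁻¹) / (2 * Real.pi) - C) := by
  have : NeZero d := ⟨Nat.one_le_iff_ne_zero.1 hd⟩
  refine ⟨fun α => OptimalCompliance.thetaExt_lt_top, OptimalCompliance.t₁_pos,
    OptimalCompliance.ae_differentiableAt_theta, fun α => OptimalCompliance.le_neg_deriv_theta,
    fun h => ⟨_, fun α => OptimalCompliance.rpow_div_sub_le_theta h⟩, ?_⟩
  rintro rfl
  exact ⟨_, fun α => OptimalCompliance.log_inv_div_sub_le_theta_two⟩

theorem proposition4p5 (d : ℕ) (hd : 1 ≤ d) :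
    (∀ α : ℝ, 0 < α → OptimalCompliance.thetaExt d α < ⊤) ∧
    0 < OptimalCompliance.t₁ d ∧
    (∀ᵐ α : ℝ, α ∈ Ioo 0 (OptimalCompliance.t₁ d) →
      DifferentiableAt ℝ (OptimalCompliance.theta d) α) ∧
    (∀ α ∈ Ioo 0 (OptimalCompliance.t₁ d), DifferentiableAt ℝ (OptimalCompliance.theta d) α →
      -deriv (OptimalCompliance.theta d) α ≥
        α ^ (1 - (d : ℝ)) / (d * OptimalCompliance.unitBallVolume d) - 2 * (α / d)) ∧
    (3 ≤ d → ∃ C : ℝ, ∀ α ∈ Ioo 0 (OptimalCompliance.t₁ d),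
      OptimalCompliance.theta d α ≥
        α ^ (2 - (d : ℝ)) / (d * ((d : ℝ) - 2) * OptimalCompliance.unitBallVolume d) - C) ∧
    (d = 2 → ∃ C : ℝ, ∀ α ∈ Ioo 0 (OptimalCompliance.t₁ d),
      OptimalCompliance.theta d α ≥ Real.log (α⁻¹) / (2 * Real.pi) - C) := by
  obtain ⟨htop, ht₁, hdiff, hderiv, h3, h2⟩ := proposition4p5_general d hd
  exact ⟨htop, ht₁, hdiff.mono fun α h hα => h hα.1, fun α hα => hderiv α hα.1,
    fun hd => (h3 hd).imp fun C h α hα => h α hα.1, fun hd => (h2 hd).imp fun C h α hα => h α hα.1⟩
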